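/- For $\tfrac12\le\alpha\le 1$ and $x\in\mathbb R$ let $\{x\}_\alpha=\{x-\alpha+1\}+\alpha-1$, where $\{\cdot\}$ is the usual fractional part in $[0,1)$; put $A_\alpha(0)=0$, $A_\alpha(t)=|\{1/t\}_\alpha|$ for $t\ne0$, $x_0=|\{x\}_\alpha|$, $x_{n+1}=A_\alpha(x_n)$ for $n\ge0$, and $$B^{(\alpha)}(x)=\sum_{n=0}^\infty x_0x_1\cdots x_{n-1}\,\ln\frac1{x_n}\in[0,+\infty],$$ which is $+\infty$ for rational $x$. Write $B^e=B^{(1/2)}$. A locally integrable $f:\mathbb R\to\mathbb R$ is of bounded mean oscillation (BMO) if $$\|f\|_*=\sup_I\frac1{|I|}\int_I|f-f_I|\,dx<\infty,\qquad f_I=\frac1{|I|}\int_I f\,dx,$$ the supremum being over all intervals $I$ with $0<|I|<1$. Let $X_*$ be the space of functions of bounded mean oscillation that are even and $1$-periodic (almost everywhere), with functions that agree almost everywhere identified, normed by $\int_0^{1/2}|f|\,dx+\|f\|_*$. For $f\in X_*$ let $T_ef$ be the even $1$-periodic function with $(T_ef)(x)=x\,f(1/x)$ for $x\in(0,\tfrac12)$.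 Then: 1. $T_e$ is a bounded linear operator from $X_*$ to itself, and $1-T_e$ is invertible on $X_*$ (it is bijective with bounded inverse). 2. The even $1$-periodic function $\ell$ equal to $-\ln x$ on $(0,\tfrac12]$ belongs to $X_*$, and $B^e\in X_*$ with $(1-T_e)B^e=\ell$. 3. For every $\alpha\in[\tfrac12,1]$ the difference $B^{(\alpha)}-B^e$ is bounded over the irrationals: there is a constant $C$ such that $B^{(\alpha)}(x)\le B^e(x)+C$ and $B^e(x)\le B^{(\alpha)}(x)+C$ for every irrational $x$. Moreover $B^{(\alpha)}$ is finite almost everywhere and has bounded mean oscillation. -/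

import Mathlib

open MeasureTheory Set
open scoped ENNReal NNReal

noncomputable section

namespace Brjuno

/-! ### Continued fractions and Brjuno series -/

/-- `|{x}_α|`, where `{x}_α = {x - α + 1} + α - 1` and `{·}` is the usual fractional part. -/
def absFrac (α x : ℝ) : ℝ := |Int.fract (x - α + 1) + α - 1|

/-- The `α`-continued fraction map `A_α(x) = |{1/x}_α|`, with `A_α(0) = 0`. -/
def cfMap (α x : ℝ) : ℝ := if x = 0 then 0 else absFrac α x⁻¹

/-- The sequence `x_0 = |{x}_α|`, `x_{n+1} = A_α(x_n)`. -/
def cfRem (α x : ℝ) : ℕ → ℝ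
  | 0 => absFrac α x
  | n + 1 => cfMap α (cfRem α x n)

/-- `-log` with values in `[0, ∞]` on `[0, 1]`; its value at `0` is `∞`. -/
def negLog (t : ℝ) : ℝ≥0∞ := if t ≤ 0 then ∞ else ENNReal.ofReal (-Real.log t)

/-- `B^{(α)}(x) = ∑ₙ x_0 x_1 ⋯ x_{n-1} log (1 / x_n)`, as an element of `[0, ∞]`.
It is `∞` at rational `x`. -/
def brjunoFun (α x : ℝ) : ℝ≥0∞ :=
  ∑' n : ℕ, ENNReal.ofReal (∏ k ∈ Finset.range n, cfRem α x k) * negLog (cfRem α x n)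

/-- The operator `T_e = T_{(1/2)}`: `(T_e f)(x) = x f(1/x)` on `(0, 1/2)`, extended to an even
function of period `1`.  Here `absFrac (1/2) x` is the distance from `x` to the nearest integer,
so that it equals `x` for `x ∈ (0, 1/2)` and it is even and `1`-periodic. -/
def evenOp (f : ℝ → ℝ) (x : ℝ) : ℝ := absFrac (1 / 2) x * f (absFrac (1 / 2) x)⁻¹

/-- The function `-log x` on `(0, 1/2]`, extended to an even function of period `1`. -/
def evenNegLog (x : ℝ) : ℝ := -Real.log (absFrac (1 / 2) x)

/-! ### Bounded mean oscillation -/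

/-- The mean of `f` over the interval with end points `a < b`. -/
def intervalMean (f : ℝ → ℝ) (a b : ℝ) : ℝ := (b - a)⁻¹ * ∫ x in a..b, f x

/-- The mean oscillation of `f` over the interval with end points `a < b`. -/
def meanOsc (f : ℝ → ℝ) (a b : ℝ) : ℝ :=
  intervalMean (fun x => |f x - intervalMean f a b|) a b

/-- The mean oscillations of `f` over all intervals of length smaller than one. -/
def oscSet (f : ℝ → ℝ) : Set ℝ := {r | ∃ a b : ℝ, a < b ∧ b - a < 1 ∧ r = meanOsc f a b}

/-- `f` is locally integrable and has bounded mean oscillation. -/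
def IsBMO (f : ℝ → ℝ) : Prop := LocallyIntegrable f volume ∧ BddAbove (oscSet f)

/-- The seminorm `‖f‖_*` (meaningful if `IsBMO f`). -/
def bmoSeminorm (f : ℝ → ℝ) : ℝ := sSup (oscSet f)

/-- `f` has bounded mean oscillation, and it is `1`-periodic and even up to null sets. -/
def MemXStar (f : ℝ → ℝ) : Prop :=
  IsBMO f ∧ (∀ᵐ x ∂volume, f (x + 1) = f x) ∧ (∀ᵐ x ∂volume, f (-x) = f x)

/-- The norm `∫₀^{1/2} |f| + ‖f‖_*`. -/
def xStarNorm (f : ℝ → ℝ) : ℝ := (∫ x in (0 : ℝ)..(1 / 2), |f x|) + bmoSeminorm f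

/-! ### Elementary facts on mean oscillations -/

theorem intervalMean_congr {f g : ℝ → ℝ} (h : f =ᵐ[volume] g) (a b : ℝ) :
    intervalMean f a b = intervalMean g a b := by
  unfold intervalMean
  rw [intervalIntegral.integral_congr_ae (h.mono fun x hx _ => hx)]

theorem meanOsc_congr {f g : ℝ → ℝ} (h : f =ᵐ[volume] g) (a b : ℝ) :
    meanOsc f a b = meanOsc g a b := by
  unfold meanOsc
  rw [intervalMean_congr h a b]
  exact intervalMean_congr (h.mono fun x hx => by simp only [hx]) a b

theorem oscSet_congr {f g : ℝ → ℝ} (h : f =ᵐ[volume] g) : oscSet f = oscSet g := by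
  unfold oscSet
  simp only [meanOsc_congr h]

theorem xStarNorm_congr {f g : ℝ → ℝ} (h : f =ᵐ[volume] g) : xStarNorm f = xStarNorm g := by
  unfold xStarNorm bmoSeminorm
  rw [oscSet_congr h, intervalIntegral.integral_congr_ae
    (g := fun x => |g x|) (h.mono fun x hx _ => by simp only [hx])]

theorem meanOsc_nonneg (f : ℝ → ℝ) {a b : ℝ} (h : a < b) : 0 ≤ meanOsc f a b :=
  mul_nonneg (inv_nonneg.2 (sub_nonneg.2 h.le))
    (intervalIntegral.integral_nonneg h.le fun _ _ => abs_nonneg _)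

theorem intervalIntegrable_of_loc {f : ℝ → ℝ} (hf : LocallyIntegrable f volume) (a b : ℝ) :
    IntervalIntegrable f volume a b :=
  intervalIntegrable_iff.2 ((hf.integrableOn_isCompact isCompact_uIcc).mono_set uIoc_subset_uIcc)

theorem meanOsc_add_le {f g : ℝ → ℝ} (hf : LocallyIntegrable f volume)
    (hg : LocallyIntegrable g volume) {a b : ℝ} (h : a < b) :
    meanOsc (f + g) a b ≤ meanOsc f a b + meanOsc g a b := by
  have hf' := intervalIntegrable_of_loc hf a b
  have hg' := intervalIntegrable_of_loc hg a b
  have hm : intervalMean (f + g) a b = intervalMean f a b + intervalMean g a b := by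
    unfold intervalMean
    rw [← mul_add, ← intervalIntegral.integral_add hf' hg']
    rfl
  have hfi : IntervalIntegrable (fun x => |f x - intervalMean f a b|) volume a b :=
    (hf'.sub intervalIntegrable_const).abs
  have hgi : IntervalIntegrable (fun x => |g x - intervalMean g a b|) volume a b :=
    (hg'.sub intervalIntegrable_const).abs
  have hfg : IntervalIntegrable (fun x => |(f + g) x - intervalMean (f + g) a b|) volume a b :=
    ((hf'.add hg').sub intervalIntegrable_const).abs
  change (b - a)⁻¹ * (∫ x in a..b, |(f + g) x - intervalMean (f + g) a b|) ≤
    (b - a)⁻¹ * (∫ x in a..b, |f x - intervalMean f a b|) +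
    (b - a)⁻¹ * (∫ x in a..b, |g x - intervalMean g a b|)
  rw [← mul_add, ← intervalIntegral.integral_add hfi hgi]
  refine mul_le_mul_of_nonneg_left ?_ (inv_nonneg.2 (sub_nonneg.2 h.le))
  refine intervalIntegral.integral_mono_on h.le hfg (hfi.add hgi) fun x _ => ?_
  rw [hm, Pi.add_apply, add_sub_add_comm]
  exact abs_add_le _ _

theorem meanOsc_smul (c : ℝ) (f : ℝ → ℝ) (a b : ℝ) :
    meanOsc (c • f) a b = |c| * meanOsc f a b := by
  have hm : intervalMean (c • f) a b = c * intervalMean f a b := by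
    unfold intervalMean
    simp only [Pi.smul_apply, smul_eq_mul, intervalIntegral.integral_const_mul]
    ring
  change (b - a)⁻¹ * (∫ x in a..b, |(c • f) x - intervalMean (c • f) a b|) =
    |c| * ((b - a)⁻¹ * (∫ x in a..b, |f x - intervalMean f a b|))
  rw [hm]
  simp only [Pi.smul_apply, smul_eq_mul, ← mul_sub, abs_mul, intervalIntegral.integral_const_mul]
  ring

theorem oscSet_nonempty (f : ℝ → ℝ) : (oscSet f).Nonempty :=
  ⟨_, 0, 1 / 2, by norm_num, by norm_num, rfl⟩

theorem bmoSeminorm_nonneg (f : ℝ → ℝ) : 0 ≤ bmoSeminorm f := by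
  refine Real.sSup_nonneg ?_
  rintro r ⟨a, b, hab, -, rfl⟩
  exact meanOsc_nonneg f hab

theorem bmoSeminorm_add_le {f g : ℝ → ℝ} (hf : IsBMO f) (hg : IsBMO g) :
    bmoSeminorm (f + g) ≤ bmoSeminorm f + bmoSeminorm g := by
  refine csSup_le (oscSet_nonempty _) ?_
  rintro r ⟨a, b, hab, hab', rfl⟩
  exact (meanOsc_add_le hf.1 hg.1 hab).trans
    (add_le_add (le_csSup hf.2 ⟨a, b, hab, hab', rfl⟩) (le_csSup hg.2 ⟨a, b, hab, hab', rfl⟩))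

theorem oscSet_smul (c : ℝ) (f : ℝ → ℝ) : oscSet (c • f) = (fun r => |c| * r) '' oscSet f := by
  ext r
  constructor
  · rintro ⟨a, b, h, h', rfl⟩
    exact ⟨_, ⟨a, b, h, h', rfl⟩, (meanOsc_smul c f a b).symm⟩
  · rintro ⟨_, ⟨a, b, h, h', rfl⟩, rfl⟩
    exact ⟨a, b, h, h', (meanOsc_smul c f a b).symm⟩

theorem bmoSeminorm_smul (c : ℝ) (f : ℝ → ℝ) : bmoSeminorm (c • f) = |c| * bmoSeminorm f := by
  unfold bmoSeminorm
  rw [oscSet_smul]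
  exact Real.sSup_smul_of_nonneg (abs_nonneg c) (oscSet f)

theorem isBMO_add {f g : ℝ → ℝ} (hf : IsBMO f) (hg : IsBMO g) : IsBMO (f + g) := by
  refine ⟨hf.1.add hg.1, bmoSeminorm f + bmoSeminorm g, ?_⟩
  rintro r ⟨a, b, hab, hab', rfl⟩
  exact (meanOsc_add_le hf.1 hg.1 hab).trans
    (add_le_add (le_csSup hf.2 ⟨a, b, hab, hab', rfl⟩) (le_csSup hg.2 ⟨a, b, hab, hab', rfl⟩))

theorem isBMO_smul (c : ℝ) {f : ℝ → ℝ} (hf : IsBMO f) : IsBMO (c • f) := by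
  refine ⟨hf.1.smul c, ?_⟩
  rw [oscSet_smul]
  exact (monotone_mul_left_of_nonneg (abs_nonneg c)).map_bddAbove hf.2

/-! ### The normed space `X_*` -/

theorem memXStar_congr {f g : ℝ → ℝ} (h : f =ᵐ[volume] g) (hf : MemXStar f) : MemXStar g := by
  have h1 : ∀ᵐ x ∂(volume : Measure ℝ), f (x + 1) = g (x + 1) :=
    (measurePreserving_add_right volume (1 : ℝ)).quasiMeasurePreserving.ae h
  have h2 : ∀ᵐ x ∂(volume : Measure ℝ), f (-x) = g (-x) :=
    (Measure.measurePreserving_neg (volume : Measure ℝ)).quasiMeasurePreserving.ae h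
  refine ⟨⟨(locallyIntegrable_congr h).1 hf.1.1, oscSet_congr h ▸ hf.1.2⟩, ?_, ?_⟩
  · filter_upwards [h, h1, hf.2.1] with x a b c
    rw [← a, ← b, c]
  · filter_upwards [h, h2, hf.2.2] with x a b c
    rw [← a, ← b, c]

theorem memXStar_add {f g : ℝ → ℝ} (hf : MemXStar f) (hg : MemXStar g) : MemXStar (f + g) := by
  refine ⟨isBMO_add hf.1 hg.1, ?_, ?_⟩
  · filter_upwards [hf.2.1, hg.2.1] with x a b
    simp only [Pi.add_apply, a, b]
  · filter_upwards [hf.2.2, hg.2.2] with x a b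
    simp only [Pi.add_apply, a, b]

theorem memXStar_smul (c : ℝ) {f : ℝ → ℝ} (hf : MemXStar f) : MemXStar (c • f) := by
  refine ⟨isBMO_smul c hf.1, ?_, ?_⟩
  · filter_upwards [hf.2.1] with x a
    simp only [Pi.smul_apply, a]
  · filter_upwards [hf.2.2] with x a
    simp only [Pi.smul_apply, a]

theorem memXStar_zero : MemXStar (0 : ℝ → ℝ) := by
  refine ⟨⟨locallyIntegrable_zero, 0, ?_⟩, by simp, by simp⟩
  rintro r ⟨a, b, -, -, rfl⟩
  simp [meanOsc, intervalMean]

/-- The space `X_*` of even, `1`-periodic functions of bounded mean oscillation, two functions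
being identified if they agree almost everywhere. -/
def XStar : Submodule ℝ (ℝ →ₘ[volume] ℝ) where
  carrier := {f | MemXStar f}
  add_mem' {f g} hf hg := memXStar_congr (AEEqFun.coeFn_add f g).symm (memXStar_add hf hg)
  zero_mem' := memXStar_congr AEEqFun.coeFn_zero.symm memXStar_zero
  smul_mem' c f hf := memXStar_congr (AEEqFun.coeFn_smul c f).symm (memXStar_smul c hf)

/-- The element of `X_*` given by a function. -/
def XStar.ofFun (f : ℝ → ℝ) (hf : MemXStar f) : XStar :=
  ⟨AEEqFun.mk f hf.1.1.aestronglyMeasurable,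
    memXStar_congr (AEEqFun.coeFn_mk f hf.1.1.aestronglyMeasurable).symm hf⟩

theorem ae_eq_zero_of_xStarNorm {f : ℝ → ℝ} (hf : MemXStar f) (h : xStarNorm f = 0) :
    f =ᵐ[volume] 0 := by
  have hI0 : 0 ≤ ∫ x in (0 : ℝ)..(1 / 2), |f x| :=
    intervalIntegral.integral_nonneg (by norm_num) fun _ _ => abs_nonneg _
  have hI : ∫ x in (0 : ℝ)..(1 / 2), |f x| = 0 := by
    have := bmoSeminorm_nonneg f
    unfold xStarNorm at h
    linarith
  rw [intervalIntegral.integral_eq_zero_iff_of_le_of_nonneg_ae (by norm_num)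
    (Filter.Eventually.of_forall fun _ => abs_nonneg _)
    (intervalIntegrable_of_loc hf.1.1 _ _).abs] at hI
  have h1 : ∀ᵐ x ∂(volume : Measure ℝ), x ∈ Ioc (0 : ℝ) (1 / 2) → f x = 0 := by
    rw [Filter.EventuallyEq, ae_restrict_iff' measurableSet_Ioc] at hI
    exact hI.mono fun x hx hx' => abs_eq_zero.1 (hx hx')
  have h2 : ∀ᵐ x ∂(volume : Measure ℝ), -x ∈ Ioc (0 : ℝ) (1 / 2) → f (-x) = 0 :=
    (Measure.measurePreserving_neg (volume : Measure ℝ)).quasiMeasurePreserving.ae h1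
  have h3 : ∀ᵐ x ∂(volume : Measure ℝ), |x| ≤ 1 / 2 → f x = 0 := by
    filter_upwards [h1, h2, hf.2.2, Measure.ae_ne volume (0 : ℝ)] with x a b c hx hx'
    rw [abs_le] at hx'
    rcases lt_or_gt_of_ne hx with h0 | h0
    · rw [← c]
      exact b ⟨by linarith, by linarith⟩
    · exact a ⟨h0, hx'.2⟩
  have hs : ∀ (n : ℤ) {p : ℝ → Prop}, (∀ᵐ x ∂(volume : Measure ℝ), p x) →
      ∀ᵐ x ∂(volume : Measure ℝ), p (x + n) := fun n p hp =>
    (measurePreserving_add_right volume (n : ℝ)).quasiMeasurePreserving.ae hp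
  have h4 : ∀ n : ℤ, ∀ᵐ x ∂(volume : Measure ℝ), f (x + n) = f x := by
    intro n
    induction n with
    | zero => simp
    | succ k ih =>
      filter_upwards [ih, hs k hf.2.1] with x a b
      rw [← a, ← b]
      push_cast
      ring_nf
    | pred k ih =>
      filter_upwards [ih, hs (-(k : ℤ) - 1) hf.2.1] with x a b
      rw [← a, ← b]
      push_cast
      ring_nf
  have h5 : ∀ᵐ x ∂(volume : Measure ℝ), ∀ n : ℤ,
      f (x + n) = f x ∧ (|x + n| ≤ 1 / 2 → f (x + n) = 0) := by
    rw [ae_all_iff]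
    intro n
    filter_upwards [h4 n, hs n h3] with x a b
    exact ⟨a, b⟩
  filter_upwards [h5] with x hx
  obtain ⟨a, b⟩ := hx (-round x)
  rw [Pi.zero_apply, ← a]
  refine b ?_
  push_cast
  rw [← sub_eq_add_neg]
  exact abs_sub_round x

instance : Norm XStar := ⟨fun f => xStarNorm (f : ℝ →ₘ[volume] ℝ)⟩

theorem XStar.norm_def (f : XStar) : ‖f‖ = xStarNorm (f : ℝ →ₘ[volume] ℝ) := rfl

theorem XStar.normCore : NormedSpace.Core ℝ XStar where
  norm_nonneg f := add_nonneg
    (intervalIntegral.integral_nonneg (by norm_num) fun _ _ => abs_nonneg _) (bmoSeminorm_nonneg _)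
  norm_smul c f := by
    rw [XStar.norm_def, XStar.norm_def, Submodule.coe_smul,
      xStarNorm_congr (AEEqFun.coeFn_smul c (f : ℝ →ₘ[volume] ℝ))]
    unfold xStarNorm
    rw [bmoSeminorm_smul]
    simp only [Pi.smul_apply, smul_eq_mul, abs_mul, intervalIntegral.integral_const_mul,
      Real.norm_eq_abs]
    ring
  norm_triangle f g := by
    rw [XStar.norm_def, XStar.norm_def, XStar.norm_def, Submodule.coe_add,
      xStarNorm_congr (AEEqFun.coeFn_add (f : ℝ →ₘ[volume] ℝ) (g : ℝ →ₘ[volume] ℝ))]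
    have hf : MemXStar (f : ℝ →ₘ[volume] ℝ) := f.2
    have hg : MemXStar (g : ℝ →ₘ[volume] ℝ) := g.2
    have h1 := bmoSeminorm_add_le hf.1 hg.1
    have hf' := intervalIntegrable_of_loc hf.1.1 0 (1 / 2)
    have hg' := intervalIntegrable_of_loc hg.1.1 0 (1 / 2)
    have h2 := intervalIntegral.integral_mono_on (by norm_num) (hf'.add hg').abs
      (hf'.abs.add hg'.abs) fun x _ => abs_add_le _ _
    rw [intervalIntegral.integral_add hf'.abs hg'.abs] at h2
    unfold xStarNorm
    simp only [Pi.add_apply] at h1 h2 ⊢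
    linarith
  norm_eq_zero_iff f := by
    constructor
    · intro h
      have h0 := ae_eq_zero_of_xStarNorm (show MemXStar (f : ℝ →ₘ[volume] ℝ) from f.2) h
      exact Subtype.ext (AEEqFun.ext (h0.trans AEEqFun.coeFn_zero.symm))
    · rintro rfl
      rw [XStar.norm_def, Submodule.coe_zero, xStarNorm_congr AEEqFun.coeFn_zero]
      have h := bmoSeminorm_smul 0 (0 : ℝ → ℝ)
      rw [zero_smul, abs_zero, zero_mul] at h
      simp [xStarNorm, h]

instance : NormedAddCommGroup XStar := NormedAddCommGroup.ofCore XStar.normCore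

instance : NormedSpace ℝ XStar := NormedSpace.ofCore XStar.normCore

end Brjuno

end

noncomputable section

namespace Brjuno

/-! Write T for `evenOp`. Two numbers are attached to an even 1-periodic f (`OscControl`): a bound A
for its L¹ norm on (0, 1/2), and a bound r for its mean oscillation over intervals of length at most
1/4. The substitution y = 1/x turns integrals of Tf into integrals against y⁻³ dy over y > 2, and
twice the sum of j⁻³ over j ≥ 2 is at most 1/2, so T halves A (`EvenPeriodic.halfL1_evenOp_le`). An
interval (a, b) in (0, 1/2) that is short compared with a² is carried by 1/x to an interval of
length at most 1/4; if f is near c there, then Tf is near cx on (a, b). The factor x ≤ 1/2 outweighs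
the small distortion of 1/x, so r is multiplied by at most 3/4, up to a multiple of A. On longer
intervals ∫₀ᵗ |Tf| ≤ 5t²A suffices. Altogether (r, A) becomes (3r/4 + 200A, A/2)
(`OscControl.evenOp`).

Hence r + 1000A, which is comparable with the norm of X_*, shrinks by the factor 3/4 under T, and
the Neumann series inverts 1 - T (`OscControl.neumann`). At irrational points B^e is, term by term,
the Neumann series of ℓ, and ℓ has bounded mean oscillation because the logarithm has (`oscLE_log`).

The other B^(α) are compared with the Gauss case α = 1. The steps differ only when the fractional
part t is at least α; then one α-step merges two Gauss steps. Both routes reach the same tail with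
the same weight 1 - t, and the terms collected differ by (1 - t) log(t/(1 - t)), a number in [0, 1].
Since later errors are damped by factors at most α, B^(1) ≤ B^(α) ≤ B^(1) + 1/(1 - α) for α < 1. A
bounded perturbation does not affect bounded mean oscillation. -/

/-! ### Distance to the nearest integer, and even periodic functions -/

theorem absFrac_half (x : ℝ) : absFrac (1 / 2) x = |x - round x| := by
  unfold absFrac
  have h : x - 1 / 2 + 1 = x + 1 / 2 := by ring
  rw [h, round_eq, Int.fract]
  congr 1
  ring

theorem absFrac_half_nonneg (x : ℝ) : 0 ≤ absFrac (1 / 2) x := abs_nonneg _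

theorem absFrac_half_le (x : ℝ) : absFrac (1 / 2) x ≤ 1 / 2 := by
  rw [absFrac_half]
  exact abs_sub_round x

theorem absFrac_half_of_mem {x : ℝ} (h0 : 0 ≤ x) (h1 : x ≤ 1 / 2) : absFrac (1 / 2) x = x := by
  rw [absFrac_half, abs_sub_round_eq_min, Int.fract_eq_self.2 ⟨h0, by linarith⟩]
  exact min_eq_left (by linarith)

theorem absFrac_half_add_int (x : ℝ) (n : ℤ) :
    absFrac (1 / 2) (x + n) = absFrac (1 / 2) x := by
  rw [absFrac_half, absFrac_half, round_add_intCast]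
  push_cast
  congr 1
  ring

theorem absFrac_half_neg (x : ℝ) : absFrac (1 / 2) (-x) = absFrac (1 / 2) x := by
  rw [absFrac_half, absFrac_half, abs_sub_round_eq_min, abs_sub_round_eq_min]
  rcases eq_or_ne (Int.fract x) 0 with h | h
  · rw [h, Int.fract_neg_eq_zero.2 h]
  · rw [Int.fract_neg h, sub_sub_cancel, min_comm]

theorem absFrac_half_idem (x : ℝ) :
    absFrac (1 / 2) (absFrac (1 / 2) x) = absFrac (1 / 2) x :=
  absFrac_half_of_mem (absFrac_half_nonneg x) (absFrac_half_le x)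

theorem measurable_absFrac (α : ℝ) : Measurable (absFrac α) := by
  unfold absFrac
  exact (((measurable_fract.comp (by fun_prop)).add_const α).sub_const 1).abs

/-- Invariance under the distance to the nearest integer: evenness together with period one. -/
def EvenPeriodic (f : ℝ → ℝ) : Prop := ∀ x, f (absFrac (1 / 2) x) = f x

theorem EvenPeriodic.neg {f : ℝ → ℝ} (hf : EvenPeriodic f) (x : ℝ) : f (-x) = f x := by
  rw [← hf, absFrac_half_neg, hf]

theorem EvenPeriodic.add_int {f : ℝ → ℝ} (hf : EvenPeriodic f) (x : ℝ) (n : ℤ) :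
    f (x + n) = f x := by
  rw [← hf, absFrac_half_add_int, hf]

theorem EvenPeriodic.int_sub {f : ℝ → ℝ} (hf : EvenPeriodic f) (n : ℤ) (x : ℝ) :
    f (n - x) = f x := by
  rw [sub_eq_neg_add, hf.add_int, hf.neg]

theorem evenPeriodic_evenOp (f : ℝ → ℝ) : EvenPeriodic (evenOp f) := fun x => by
  unfold evenOp
  rw [absFrac_half_idem]

theorem evenOp_of_mem (f : ℝ → ℝ) {x : ℝ} (h0 : 0 ≤ x) (h1 : x ≤ 1 / 2) :
    evenOp f x = x * f x⁻¹ := by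
  unfold evenOp
  rw [absFrac_half_of_mem h0 h1]

theorem evenOp_measurable {f : ℝ → ℝ} (hf : Measurable f) : Measurable (evenOp f) :=
  (measurable_absFrac _).mul (hf.comp (measurable_absFrac _).inv)

/-! ### Changes of variables -/

theorem setLIntegral_Ioo_add (g : ℝ → ℝ≥0∞) (a b n : ℝ) :
    ∫⁻ x in Ioo a b, g (x + n) = ∫⁻ x in Ioo (a + n) (b + n), g x := by
  have h := (measurePreserving_add_right volume n).setLIntegral_comp_preimage_emb
    (MeasurableEquiv.addRight n).measurableEmbedding g (Ioo (a + n) (b + n))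
  rw [preimage_add_const_Ioo, add_sub_cancel_right, add_sub_cancel_right] at h
  exact h

theorem setLIntegral_Ioo_sub (g : ℝ → ℝ≥0∞) (a b n : ℝ) :
    ∫⁻ x in Ioo a b, g (n - x) = ∫⁻ x in Ioo (n - b) (n - a), g x := by
  have h := (Measure.measurePreserving_sub_left volume n).setLIntegral_comp_preimage_emb
    (MeasurableEquiv.subLeft n).measurableEmbedding g (Ioo (n - b) (n - a))
  rw [preimage_const_sub_Ioo, sub_sub_cancel, sub_sub_cancel] at h
  exact h

theorem setLIntegral_Ioo_split (g : ℝ → ℝ≥0∞) {a b c : ℝ} (h1 : a < b) (h2 : b < c) :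
    ∫⁻ x in Ioo a c, g x = (∫⁻ x in Ioo a b, g x) + ∫⁻ x in Ioo b c, g x := by
  have h : (Ioo a b ∪ Ioo b c : Set ℝ) =ᵐ[volume] (Ioo a c : Set ℝ) := by
    rw [← Ioo_union_Ico_eq_Ioo h1 h2.le]
    exact ae_eq_set_union Filter.EventuallyEq.rfl Ioo_ae_eq_Ico
  rw [← setLIntegral_congr h, lintegral_union measurableSet_Ioo]
  exact Ioo_disjoint_Ioo.2 (by simp [h1.le, h2.le])

theorem setLIntegral_Ioo_inv (g : ℝ → ℝ≥0∞) {a b : ℝ} (ha : 0 < a) (hb : 0 < b) :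
    ∫⁻ x in Ioo a b, g x =
      ∫⁻ y in Ioo b⁻¹ a⁻¹, ENNReal.ofReal (y ^ 2)⁻¹ * g y⁻¹ := by
  have himg : (fun y : ℝ => y⁻¹) '' Ioo b⁻¹ a⁻¹ = Ioo a b := by
    ext x
    constructor
    · rintro ⟨y, ⟨h1, h2⟩, rfl⟩
      have hy : 0 < y := (inv_pos.2 hb).trans h1
      exact ⟨(lt_inv_comm₀ ha hy).2 h2, (inv_lt_comm₀ hb hy).1 h1⟩
    · rintro ⟨h1, h2⟩
      exact ⟨x⁻¹, ⟨(inv_lt_inv₀ hb (ha.trans h1)).2 h2, (inv_lt_inv₀ (ha.trans h1) ha).2 h1⟩,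
        inv_inv x⟩
  rw [← himg, lintegral_image_eq_lintegral_abs_deriv_mul measurableSet_Ioo
    (f' := fun y => -(y ^ 2)⁻¹) (fun y hy =>
      (hasDerivAt_inv ((inv_pos.2 hb).trans hy.1).ne').hasDerivWithinAt)
    inv_injective.injOn]
  refine lintegral_congr fun y => ?_
  rw [abs_neg, abs_of_nonneg (by positivity)]

theorem setLIntegral_Ioo_zero_inv (g : ℝ → ℝ≥0∞) {b : ℝ} (hb : 0 < b) :
    ∫⁻ x in Ioo 0 b, g x = ∫⁻ y in Ioi b⁻¹, ENNReal.ofReal (y ^ 2)⁻¹ * g y⁻¹ := by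
  have himg : (fun y : ℝ => y⁻¹) '' Ioi b⁻¹ = Ioo 0 b := by
    ext x
    constructor
    · rintro ⟨y, h1, rfl⟩
      have hy : 0 < y := (inv_pos.2 hb).trans h1
      exact ⟨inv_pos.2 hy, (inv_lt_comm₀ hb hy).1 h1⟩
    · rintro ⟨h1, h2⟩
      exact ⟨x⁻¹, (inv_lt_inv₀ hb h1).2 h2, inv_inv x⟩
  rw [← himg, lintegral_image_eq_lintegral_abs_deriv_mul measurableSet_Ioi
    (f' := fun y => -(y ^ 2)⁻¹) (fun y hy =>
      (hasDerivAt_inv ((inv_pos.2 hb).trans hy).ne').hasDerivWithinAt)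
    inv_injective.injOn]
  refine lintegral_congr fun y => ?_
  rw [abs_neg, abs_of_nonneg (by positivity)]

/-- Inversion is differentiable off 0, so it maps null sets to null sets. With the next lemma this
makes `evenOp` well defined on classes of functions. -/
theorem ae_inv_of_ae {p : ℝ → Prop} (h : ∀ᵐ x ∂(volume : Measure ℝ), p x) :
    ∀ᵐ x ∂(volume : Measure ℝ), p x⁻¹ := by
  have h0 : volume ((fun y : ℝ => y⁻¹) '' ({x | ¬p x} \ {0})) = 0 :=
    addHaar_image_eq_zero_of_differentiableOn_of_addHaar_eq_zero volume
      (fun y hy => (differentiableAt_inv hy.2).differentiableWithinAt)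
      (measure_mono_null sdiff_subset h)
  filter_upwards [measure_eq_zero_iff_ae_notMem.1 h0, Measure.ae_ne volume (0 : ℝ)] with x hx hx0
  by_contra hp
  exact hx ⟨x⁻¹, ⟨hp, inv_ne_zero hx0⟩, inv_inv x⟩

theorem ae_absFrac_half_of_ae {p : ℝ → Prop} (h : ∀ᵐ x ∂(volume : Measure ℝ), p x) :
    ∀ᵐ x ∂(volume : Measure ℝ), p (absFrac (1 / 2) x) := by
  have h1 : ∀ᵐ x ∂(volume : Measure ℝ), ∀ n : ℤ, p (x - n) ∧ p (n - x) := by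
    rw [ae_all_iff]
    exact fun n => ((measurePreserving_sub_right volume (n : ℝ)).quasiMeasurePreserving.ae h).and
      ((Measure.measurePreserving_sub_left volume (n : ℝ)).quasiMeasurePreserving.ae h)
  filter_upwards [h1] with x hx
  rw [absFrac_half]
  rcases abs_choice (x - round x) with h | h <;> rw [h]
  · exact (hx _).1
  · rw [neg_sub]
    exact (hx _).2

theorem evenOp_congr {f g : ℝ → ℝ} (h : f =ᵐ[volume] g) : evenOp f =ᵐ[volume] evenOp g := by
  filter_upwards [ae_absFrac_half_of_ae (ae_inv_of_ae h)] with x hx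
  unfold evenOp
  rw [hx]

theorem evenOp_aemeasurable {f : ℝ → ℝ} (hf : AEMeasurable f volume) :
    AEMeasurable (evenOp f) volume :=
  ⟨evenOp (hf.mk f), evenOp_measurable hf.measurable_mk, evenOp_congr hf.ae_eq_mk⟩

theorem comp_absFrac_half_ae_eq {f : ℝ → ℝ} (h1 : ∀ᵐ x ∂volume, f (x + 1) = f x)
    (h2 : ∀ᵐ x ∂volume, f (-x) = f x) :
    (fun x => f (absFrac (1 / 2) x)) =ᵐ[volume] f := by
  have hs : ∀ (n : ℤ) {p : ℝ → Prop}, (∀ᵐ x ∂(volume : Measure ℝ), p x) →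
      ∀ᵐ x ∂(volume : Measure ℝ), p (x + n) := fun n p hp =>
    (measurePreserving_add_right volume (n : ℝ)).quasiMeasurePreserving.ae hp
  have h3 : ∀ n : ℤ, ∀ᵐ x ∂(volume : Measure ℝ), f (x + n) = f x := by
    intro n
    induction n with
    | zero => simp
    | succ k ih =>
      filter_upwards [ih, hs k h1] with x a b
      rw [← a, ← b]
      push_cast
      ring_nf
    | pred k ih =>
      filter_upwards [ih, hs (-(k : ℤ) - 1) h1] with x a b
      rw [← a, ← b]
      push_cast
      ring_nf
  have h4 : ∀ᵐ x ∂(volume : Measure ℝ), ∀ n : ℤ, f (x + n) = f x ∧ f (-(x + n)) = f (x + n) := by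
    rw [ae_all_iff]
    exact fun n => (h3 n).and (hs n h2)
  filter_upwards [h4] with x hx
  obtain ⟨a, b⟩ := hx (-round x)
  push_cast at a b
  rw [← sub_eq_add_neg] at a b
  rw [absFrac_half]
  rcases abs_choice (x - round x) with h | h <;> rw [h]
  · exact a
  · rw [b, a]

/-! ### L¹ estimates for the operator -/

/-- The integral of `|f|` over `(0, 1/2)`. -/
def halfL1 (f : ℝ → ℝ) : ℝ≥0∞ := ∫⁻ x in Ioo (0 : ℝ) (1 / 2), ‖f x‖ₑ

theorem EvenPeriodic.setLIntegral_unit {f : ℝ → ℝ} (hf : EvenPeriodic f) (n : ℤ) :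
    ∫⁻ x in Ioo (n : ℝ) (n + 1), ‖f x‖ₑ = 2 * halfL1 f := by
  have h1 := setLIntegral_Ioo_add (fun x => ‖f x‖ₑ) 0 (1 / 2) n
  have h2 := setLIntegral_Ioo_sub (fun x => ‖f x‖ₑ) 0 (1 / 2) ((n + 1 : ℤ) : ℝ)
  simp only [hf.add_int] at h1
  simp only [hf.int_sub] at h2
  rw [setLIntegral_Ioo_split _ (b := (1 / 2 : ℝ) + n) (by linarith) (by linarith), two_mul]
  unfold halfL1
  nth_rw 1 [h1]
  rw [h2]
  push_cast
  ring_nf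

theorem EvenPeriodic.setLIntegral_le {f : ℝ → ℝ} (hf : EvenPeriodic f) {a b : ℝ}
    (hab : b - a ≤ 1) : ∫⁻ x in Ioo a b, ‖f x‖ₑ ≤ 4 * halfL1 f := by
  have h1 := Int.floor_le a
  have h2 := Int.lt_floor_add_one a
  have h3 := hf.setLIntegral_unit (⌊a⌋ + 1)
  push_cast at h3
  calc ∫⁻ x in Ioo a b, ‖f x‖ₑ ≤ ∫⁻ x in Ioo (⌊a⌋ : ℝ) (⌊a⌋ + 1 + 1), ‖f x‖ₑ :=
        lintegral_mono_set (Ioo_subset_Ioo h1 (by linarith))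
    _ = 2 * halfL1 f + 2 * halfL1 f := by
        rw [setLIntegral_Ioo_split _ (b := (⌊a⌋ : ℝ) + 1) (by linarith) (by linarith), h3,
          hf.setLIntegral_unit]
    _ = 4 * halfL1 f := by ring

/-- Telescoping: 1/y³ ≤ 1/((y-1)y(y+1)), which is the difference of 1/(2y(y-1)) at y and y + 1. -/
theorem tsum_ofReal_inv_cube_le {K : ℕ} (hK : 2 ≤ K) :
    ∑' j : ℕ, ENNReal.ofReal (1 / ((K : ℝ) + j) ^ 3) ≤
      ENNReal.ofReal (1 / (2 * ((K : ℝ) * (K - 1)))) := by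
  have hK' : (2 : ℝ) ≤ K := by exact_mod_cast hK
  refine ENNReal.tsum_le_of_sum_range_le fun n => ?_
  rw [← ENNReal.ofReal_sum_of_nonneg fun i _ => by positivity]
  refine ENNReal.ofReal_le_ofReal ?_
  have h : ∑ i ∈ Finset.range n, 1 / ((K : ℝ) + i) ^ 3 ≤
      1 / (2 * ((K : ℝ) * (K - 1))) - 1 / (2 * (((K : ℝ) + n) * (K + n - 1))) := by
    induction n with
    | zero => simp
    | succ n ih =>
      rw [Finset.sum_range_succ]
      have hn : (0 : ℝ) ≤ n := n.cast_nonneg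
      set y : ℝ := (K : ℝ) + n with hy
      have hy2 : 2 ≤ y := by linarith
      have hkey : 1 / y ^ 3 ≤ 1 / (2 * (y * (y - 1))) - 1 / (2 * ((y + 1) * (y + 1 - 1))) := by
        have e : 1 / (2 * (y * (y - 1))) - 1 / (2 * ((y + 1) * (y + 1 - 1))) =
            1 / ((y - 1) * y * (y + 1)) := by
          have : y - 1 ≠ 0 := by linarith
          have : y + 1 - 1 ≠ 0 := by linarith
          field_simp
          ring
        rw [e]
        refine one_div_le_one_div_of_le ?_ ?_
        · have : 0 < y - 1 := by linarith
          positivity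
        · nlinarith
      push_cast
      rw [← add_assoc, ← hy]
      linarith
  have h0 : 0 ≤ 1 / (2 * (((K : ℝ) + n) * (K + n - 1))) := by
    have : (0 : ℝ) ≤ K + n - 1 := by
      have : (0 : ℝ) ≤ n := n.cast_nonneg
      linarith
    positivity
  linarith

/-- The Jacobian y⁻² and the weight y⁻¹ of the operator combine to y⁻³. -/
theorem ofReal_inv_sq_mul_enorm {f : ℝ → ℝ} {y : ℝ} (hy : 2 ≤ y) (c : ℝ) :
    ENNReal.ofReal (y ^ 2)⁻¹ * ‖evenOp f y⁻¹ - c * y⁻¹‖ₑ =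
      ENNReal.ofReal (y⁻¹ ^ 3) * ‖f y - c‖ₑ := by
  have hy0 : 0 < y := by linarith
  have hy1 : y⁻¹ ≤ 1 / 2 := by
    rw [one_div]
    exact inv_anti₀ two_pos hy
  rw [evenOp_of_mem f (inv_pos.2 hy0).le hy1, inv_inv, mul_comm c, ← mul_sub, enorm_mul,
    Real.enorm_of_nonneg (inv_pos.2 hy0).le, ← mul_assoc, ← ENNReal.ofReal_mul (by positivity)]
  congr 2
  field_simp

/-- In the variable y = 1/x every unit cell [K+j, K+j+1) carries the same L¹ norm of f, with weight
at most (K+j)⁻³. -/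
theorem EvenPeriodic.setLIntegral_evenOp_le {f : ℝ → ℝ} (hf : EvenPeriodic f) {t : ℝ}
    (ht : 0 < t) {K : ℕ} (hK : 2 ≤ K) (hKt : (K : ℝ) ≤ t⁻¹) :
    ∫⁻ x in Ioo 0 t, ‖evenOp f x‖ₑ ≤ ENNReal.ofReal (1 / ((K : ℝ) * (K - 1))) * halfL1 f := by
  have hK' : (2 : ℝ) ≤ K := by exact_mod_cast hK
  have hcov : Ioi t⁻¹ ⊆ ⋃ j : ℕ, Ico ((K : ℝ) + j) (K + j + 1) := by
    intro y hy
    have hKy : (K : ℝ) ≤ y := hKt.trans (le_of_lt hy)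
    refine mem_iUnion.2 ⟨⌊y - K⌋₊, ?_, ?_⟩
    · have := Nat.floor_le (sub_nonneg.2 hKy)
      linarith
    · have := Nat.lt_floor_add_one (y - K)
      linarith
  have hterm : ∀ j : ℕ, ∫⁻ y in Ico ((K : ℝ) + j) (K + j + 1),
      ENNReal.ofReal (y ^ 2)⁻¹ * ‖evenOp f y⁻¹‖ₑ ≤
      ENNReal.ofReal (1 / ((K : ℝ) + j) ^ 3) * (2 * halfL1 f) := by
    intro j
    have hj : (0 : ℝ) ≤ j := j.cast_nonneg
    have h := hf.setLIntegral_unit ((K + j : ℕ) : ℤ)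
    push_cast at h
    rw [← h, setLIntegral_congr (Ioo_ae_eq_Ico (a := (K : ℝ) + j)),
      ← lintegral_const_mul' _ _ ENNReal.ofReal_ne_top]
    refine setLIntegral_mono' measurableSet_Ico fun y hy => ?_
    have h2 : 2 ≤ y := by linarith [hy.1]
    have e := ofReal_inv_sq_mul_enorm (f := f) h2 0
    rw [zero_mul, sub_zero, sub_zero] at e
    rw [e]
    gcongr
    rw [one_div, ← inv_pow]
    gcongr
    exact hy.1
  calc ∫⁻ x in Ioo 0 t, ‖evenOp f x‖ₑ
      = ∫⁻ y in Ioi t⁻¹, ENNReal.ofReal (y ^ 2)⁻¹ * ‖evenOp f y⁻¹‖ₑ :=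
        setLIntegral_Ioo_zero_inv _ ht
    _ ≤ ∫⁻ y in ⋃ j : ℕ, Ico ((K : ℝ) + j) (K + j + 1),
          ENNReal.ofReal (y ^ 2)⁻¹ * ‖evenOp f y⁻¹‖ₑ := lintegral_mono_set hcov
    _ ≤ ∑' j : ℕ, ∫⁻ y in Ico ((K : ℝ) + j) (K + j + 1),
          ENNReal.ofReal (y ^ 2)⁻¹ * ‖evenOp f y⁻¹‖ₑ := lintegral_iUnion_le _ _
    _ ≤ ∑' j : ℕ, ENNReal.ofReal (1 / ((K : ℝ) + j) ^ 3) * (2 * halfL1 f) :=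
        ENNReal.tsum_le_tsum hterm
    _ ≤ ENNReal.ofReal (1 / (2 * ((K : ℝ) * (K - 1)))) * (2 * halfL1 f) := by
        rw [ENNReal.tsum_mul_right]
        gcongr
        exact tsum_ofReal_inv_cube_le hK
    _ = ENNReal.ofReal (1 / ((K : ℝ) * (K - 1))) * halfL1 f := by
        rw [← mul_assoc]
        congr 1
        rw [← ENNReal.ofReal_ofNat 2, ← ENNReal.ofReal_mul
          (one_div_nonneg.2 (mul_nonneg two_pos.le (mul_nonneg (by linarith) (by linarith))))]
        congr 1
        have : (K : ℝ) - 1 ≠ 0 := by linarith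
        field_simp

theorem EvenPeriodic.halfL1_evenOp_le {f : ℝ → ℝ} (hf : EvenPeriodic f) :
    halfL1 (evenOp f) ≤ ENNReal.ofReal (1 / 2) * halfL1 f := by
  have h := hf.setLIntegral_evenOp_le (t := 1 / 2) (by norm_num) le_rfl (by norm_num)
  norm_num at h
  unfold halfL1 at h ⊢
  norm_num
  exact h

theorem EvenPeriodic.setLIntegral_evenOp_le_sq {f : ℝ → ℝ} (hf : EvenPeriodic f) {t : ℝ}
    (ht0 : 0 < t) (ht1 : t < 1) :
    ∫⁻ x in Ioo 0 t, ‖evenOp f x‖ₑ ≤ ENNReal.ofReal (5 * t ^ 2) * halfL1 f := by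
  rcases le_or_gt t (1 / 2) with ht | ht
  · have hinv : 2 ≤ t⁻¹ := by
      rw [le_inv_comm₀ two_pos ht0]
      linarith
    have hK : 2 ≤ ⌊t⁻¹⌋₊ := Nat.le_floor (by exact_mod_cast hinv)
    refine (hf.setLIntegral_evenOp_le ht0 hK (Nat.floor_le (by positivity))).trans ?_
    gcongr
    have hlt := Nat.lt_floor_add_one t⁻¹
    have hk : (2 : ℝ) ≤ (⌊t⁻¹⌋₊ : ℝ) := by exact_mod_cast hK
    set k : ℝ := (⌊t⁻¹⌋₊ : ℝ)
    rw [div_le_iff₀ (mul_pos (by linarith) (by linarith))]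
    have h1 : 1 ≤ t * (k + 1) := by
      rw [inv_lt_iff_one_lt_mul₀ ht0] at hlt
      linarith
    have h2 : 1 ≤ (t * (k + 1)) ^ 2 := one_le_pow₀ h1
    -- Equality holds at k = 2. With `h2` this gives 1 ≤ (9/2) t² k(k-1), within the constant 5.
    have h3 : 2 / 9 * (k + 1) ^ 2 ≤ k * (k - 1) := by nlinarith
    have h4 : t ^ 2 * (2 / 9 * (k + 1) ^ 2) ≤ t ^ 2 * (k * (k - 1)) := by gcongr
    nlinarith
  · calc ∫⁻ x in Ioo 0 t, ‖evenOp f x‖ₑ ≤ ∫⁻ x in Ioo ((0 : ℤ) : ℝ) ((0 : ℤ) + 1), ‖evenOp f x‖ₑ :=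
          lintegral_mono_set (Ioo_subset_Ioo (by simp) (by simp [ht1.le]))
      _ = 2 * halfL1 (evenOp f) := (evenPeriodic_evenOp f).setLIntegral_unit 0
      _ ≤ 2 * (ENNReal.ofReal (1 / 2) * halfL1 f) := by
          gcongr
          exact hf.halfL1_evenOp_le
      _ = ENNReal.ofReal 1 * halfL1 f := by
          rw [← mul_assoc, ← ENNReal.ofReal_ofNat 2, ← ENNReal.ofReal_mul (by norm_num)]
          norm_num
      _ ≤ ENNReal.ofReal (5 * t ^ 2) * halfL1 f := by
          gcongr
          nlinarith

/-- The natural model for the image of a function close to c is cx, the image of the constant c; the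
weight y⁻³ is at most b³. -/
theorem setLIntegral_evenOp_sub_le (f : ℝ → ℝ) (c : ℝ) {a b : ℝ} (ha : 0 < a) (hb0 : 0 < b)
    (hb : b ≤ 1 / 2) :
    ∫⁻ x in Ioo a b, ‖evenOp f x - c * absFrac (1 / 2) x‖ₑ ≤
      ENNReal.ofReal (b ^ 3) * ∫⁻ y in Ioo b⁻¹ a⁻¹, ‖f y - c‖ₑ := by
  have h2b : 2 ≤ b⁻¹ := by
    rw [le_inv_comm₀ two_pos hb0]
    linarith
  rw [setLIntegral_Ioo_inv _ ha hb0, ← lintegral_const_mul' _ _ ENNReal.ofReal_ne_top]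
  refine setLIntegral_mono' measurableSet_Ioo fun y hy => ?_
  have h2 : 2 ≤ y := h2b.trans hy.1.le
  have hy1 : y⁻¹ ≤ b := (inv_le_comm₀ (by linarith) hb0).2 hy.1.le
  rw [absFrac_half_of_mem (x := y⁻¹) (by positivity) (by linarith), ofReal_inv_sq_mul_enorm h2]
  gcongr

/-! ### Contraction of the mean oscillation -/

/-- Some constant approximates `f` on `(a, b)` with mean error at most `r`. -/
def OscLE (f : ℝ → ℝ) (r a b : ℝ) : Prop :=
  ∃ c : ℝ, ∫⁻ x in Ioo a b, ‖f x - c‖ₑ ≤ ENNReal.ofReal (r * (b - a))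

theorem EvenPeriodic.oscLE_add_int {f : ℝ → ℝ} (hf : EvenPeriodic f) {r a b : ℝ} (n : ℤ)
    (h : OscLE f r (a + n) (b + n)) : OscLE f r a b := by
  obtain ⟨c, hc⟩ := h
  refine ⟨c, ?_⟩
  rw [← setLIntegral_Ioo_add] at hc
  simpa only [hf.add_int, add_sub_add_right_eq_sub] using hc

theorem EvenPeriodic.oscLE_int_sub {f : ℝ → ℝ} (hf : EvenPeriodic f) {r a b : ℝ} (n : ℤ)
    (h : OscLE f r (n - b) (n - a)) : OscLE f r a b := by
  obtain ⟨c, hc⟩ := h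
  refine ⟨c, ?_⟩
  rw [← setLIntegral_Ioo_sub] at hc
  simpa only [hf.int_sub, sub_sub_sub_cancel_left] using hc

theorem oscLE_of_setLIntegral_le {f : ℝ → ℝ} {r a b : ℝ}
    (h : ∫⁻ x in Ioo a b, ‖f x‖ₑ ≤ ENNReal.ofReal (r * (b - a))) : OscLE f r a b :=
  ⟨0, by simpa only [sub_zero] using h⟩

/-- `f` is even and `1`-periodic, has mean oscillation at most `r` at small scales and its `L¹`
norm on `(0, 1/2)` is at most `A`. -/
structure OscControl (f : ℝ → ℝ) (r A : ℝ) : Prop where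
  aemeasurable : AEMeasurable f volume
  evenPeriodic : EvenPeriodic f
  nonneg_osc : 0 ≤ r
  nonneg_l1 : 0 ≤ A
  osc : ∀ a b : ℝ, a < b → b - a ≤ 1 / 4 → OscLE f r a b
  l1 : halfL1 f ≤ ENNReal.ofReal A

theorem OscControl.setLIntegral_le {f : ℝ → ℝ} {r A : ℝ} (hf : OscControl f r A) {a b : ℝ}
    (hab : b - a ≤ 1) : ∫⁻ x in Ioo a b, ‖f x‖ₑ ≤ ENNReal.ofReal (4 * A) := by
  refine (hf.evenPeriodic.setLIntegral_le hab).trans ?_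
  rw [ENNReal.ofReal_mul (by norm_num), ENNReal.ofReal_ofNat]
  gcongr
  exact hf.l1

theorem setLIntegral_Ioo_const (c a b : ℝ) :
    ∫⁻ _ in Ioo a b, ‖c‖ₑ = ENNReal.ofReal (|c| * (b - a)) := by
  rw [setLIntegral_const, Real.volume_Ioo, Real.enorm_eq_ofReal_abs,
    ENNReal.ofReal_mul (abs_nonneg c)]

/-- Triangle inequality for c = f - (f - c). Only |c| times the length is bounded, which is all that
the distortion term and the summation of constants require. -/
theorem OscControl.abs_const_le {f : ℝ → ℝ} {r A : ℝ} (hf : OscControl f r A) {a b c R : ℝ}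
    (hab' : b - a ≤ 1) (hR : 0 ≤ R)
    (hc : ∫⁻ x in Ioo a b, ‖f x - c‖ₑ ≤ ENNReal.ofReal R) :
    |c| * (b - a) ≤ 4 * A + R := by
  have hA := hf.nonneg_l1
  rw [← ENNReal.ofReal_le_ofReal_iff (by positivity), ← setLIntegral_Ioo_const c a b,
    ENNReal.ofReal_add (by positivity) hR]
  calc ∫⁻ _ in Ioo a b, ‖c‖ₑ ≤ ∫⁻ x in Ioo a b, (‖f x‖ₑ + ‖f x - c‖ₑ) := by
        refine lintegral_mono fun x => ?_
        have h : c = f x - (f x - c) := by ring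
        nth_rw 1 [h]
        exact enorm_sub_le
    _ = (∫⁻ x in Ioo a b, ‖f x‖ₑ) + ∫⁻ x in Ioo a b, ‖f x - c‖ₑ :=
        lintegral_add_left' hf.aemeasurable.restrict.enorm _
    _ ≤ _ := add_le_add (hf.setLIntegral_le hab') hc

/-- The common core for intervals left of 1/2 and across 1/2: (p, q) is the image interval, on which
f is near some c. The image function is compared with c times the distance, and the distance is then
frozen at M, at the cost |c|(M - m). -/
theorem OscControl.oscLE_evenOp_of_image {f : ℝ → ℝ} {r A : ℝ} (hf : OscControl f r A)
    {a b p q m M : ℝ} (hab : a < b) (hpq : p < q) (hpq' : q - p ≤ 1 / 4) (hm : 0 < m)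
    (hmM : m ≤ M) (hM : M ≤ 1 / 2)
    (hd : ∀ x ∈ Ioo a b, absFrac (1 / 2) x ∈ Icc m M) (hMm : M - m ≤ b - a)
    (h1 : m ^ 2 * (q - p) ≤ b - a) (h2 : b - a ≤ M ^ 2 * (q - p))
    (hcv : ∀ c : ℝ, ∫⁻ x in Ioo a b, ‖evenOp f x - c * absFrac (1 / 2) x‖ₑ ≤
      ENNReal.ofReal (M ^ 3) * ∫⁻ y in Ioo p q, ‖f y - c‖ₑ) :
    OscLE (evenOp f) (3 / 4 * r + 200 * A) a b := by
  have hr := hf.nonneg_osc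
  have hA := hf.nonneg_l1
  have hba : 0 < b - a := sub_pos.2 hab
  have hqp : 0 < q - p := sub_pos.2 hpq
  have hM0 : 0 < M := hm.trans_le hmM
  obtain ⟨c, hc⟩ := hf.osc p q hpq hpq'
  have hcabs := hf.abs_const_le (by linarith) (by positivity) hc
  refine ⟨c * M, ?_⟩
  have hpt : ∀ x ∈ Ioo a b, ‖evenOp f x - c * M‖ₑ ≤
      ‖evenOp f x - c * absFrac (1 / 2) x‖ₑ + ‖|c| * (M - m)‖ₑ := by
    intro x hx
    have e : evenOp f x - c * M =
        (evenOp f x - c * absFrac (1 / 2) x) + c * (absFrac (1 / 2) x - M) := by ring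
    rw [e]
    refine (enorm_add_le _ _).trans ?_
    gcongr
    rw [Real.enorm_eq_ofReal_abs, Real.enorm_eq_ofReal_abs, abs_mul, abs_mul, abs_abs]
    refine ENNReal.ofReal_le_ofReal (mul_le_mul_of_nonneg_left ?_ (abs_nonneg c))
    rw [abs_sub_comm, abs_of_nonneg (by linarith [(hd x hx).2]),
      abs_of_nonneg (by linarith)]
    linarith [(hd x hx).1]
  calc ∫⁻ x in Ioo a b, ‖evenOp f x - c * M‖ₑ
      ≤ ∫⁻ x in Ioo a b, (‖evenOp f x - c * absFrac (1 / 2) x‖ₑ + ‖|c| * (M - m)‖ₑ) :=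
        setLIntegral_mono' measurableSet_Ioo hpt
    _ = (∫⁻ x in Ioo a b, ‖evenOp f x - c * absFrac (1 / 2) x‖ₑ) +
          ENNReal.ofReal (|c| * (M - m) * (b - a)) := by
        rw [lintegral_add_right _ measurable_const, setLIntegral_Ioo_const,
          abs_of_nonneg (mul_nonneg (abs_nonneg c) (by linarith))]
    _ ≤ ENNReal.ofReal (M ^ 3) * ENNReal.ofReal (r * (q - p)) +
          ENNReal.ofReal (|c| * (M - m) * (b - a)) := by
        gcongr
        exact (hcv c).trans (by gcongr)
    _ = ENNReal.ofReal (M ^ 3 * (r * (q - p)) + |c| * (M - m) * (b - a)) := by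
        rw [← ENNReal.ofReal_mul (by positivity), ENNReal.ofReal_add (by positivity)
          (mul_nonneg (mul_nonneg (abs_nonneg c) (by linarith)) hba.le)]
    _ ≤ ENNReal.ofReal ((3 / 4 * r + 200 * A) * (b - a)) := by
        refine ENNReal.ofReal_le_ofReal ?_
        have hM2 : M ^ 2 ≤ 1 / 4 := by nlinarith
        have k1 : M - m ≤ M ^ 2 * (q - p) := hMm.trans h2
        -- Since M ≤ 1/2, M²/4 ≤ M/8. So m ≥ 7M/8, which is the source of 49/64.
        have k2 : M - m ≤ M / 8 := by
          have : M ^ 2 * (q - p) ≤ M ^ 2 * (1 / 4) := by gcongr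
          nlinarith
        have k3 : 49 / 64 * M ^ 2 ≤ m ^ 2 := by nlinarith
        have k4 : M ^ 2 * (q - p) ≤ 64 / 49 * (b - a) := by
          have : 49 / 64 * M ^ 2 * (q - p) ≤ m ^ 2 * (q - p) := by gcongr
          linarith
        have k5 : M ^ 3 * (r * (q - p)) ≤ 32 / 49 * r * (b - a) := by
          calc M ^ 3 * (r * (q - p)) = M * (r * (M ^ 2 * (q - p))) := by ring
            _ ≤ 1 / 2 * (r * (64 / 49 * (b - a))) := by gcongr
            _ = 32 / 49 * r * (b - a) := by ring
        have k6 : |c| * (M - m) ≤ A + r / 16 := by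
          calc |c| * (M - m) ≤ |c| * (M ^ 2 * (q - p)) := by gcongr
            _ = M ^ 2 * (|c| * (q - p)) := by ring
            _ ≤ 1 / 4 * (4 * A + r * (1 / 4)) := by
                gcongr
                exact hcabs.trans (by gcongr)
            _ = A + r / 16 := by ring
        have k7 : |c| * (M - m) * (b - a) ≤ (A + r / 16) * (b - a) := by gcongr
        have k8 : 0 ≤ r * (b - a) := by positivity
        have k9 : 0 ≤ A * (b - a) := by positivity
        -- The coefficients of r add up to 32/49 + 1/16 < 3/4.
        linarith

theorem absFrac_half_mem_Icc {a b x : ℝ} (ha : 0 ≤ a) (hab : a + b ≤ 1) (hx : x ∈ Ioo a b) :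
    absFrac (1 / 2) x ∈ Icc a (1 / 2) := by
  refine ⟨?_, absFrac_half_le x⟩
  have h := hx.1
  have h' := hx.2
  rw [absFrac_half, abs_sub_round_eq_min, Int.fract_eq_self.2 ⟨by linarith, by linarith⟩]
  exact le_min h.le (by linarith)

/-- Beyond 1/2 the distance is 1 - x, whose inverse runs through (2, 1/(1-b)). The symmetry f(4 - y)
= f(y) folds this piece to the left of 2, where it joins (2, 1/a) in a single interval. -/
theorem setLIntegral_evenOp_sub_le_of_half_lt {f : ℝ → ℝ} (hf : EvenPeriodic f) (c : ℝ) {a b : ℝ}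
    (ha : 0 < a) (ha2 : a < 1 / 2) (hb2 : 1 / 2 < b) (hb : b < 1) :
    ∫⁻ x in Ioo a b, ‖evenOp f x - c * absFrac (1 / 2) x‖ₑ ≤
      ENNReal.ofReal ((1 / 2) ^ 3) * ∫⁻ y in Ioo (4 - (1 - b)⁻¹) a⁻¹, ‖f y - c‖ₑ := by
  have ha' : 2 < a⁻¹ := by
    rw [lt_inv_comm₀ two_pos ha]
    linarith
  have hb' : 2 < (1 - b)⁻¹ := by
    rw [lt_inv_comm₀ two_pos (by linarith)]
    linarith
  rw [setLIntegral_Ioo_split _ ha2 hb2,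
    setLIntegral_Ioo_split _ (b := 2) (by linarith : 4 - (1 - b)⁻¹ < 2) ha', mul_add, add_comm]
  refine add_le_add ?_ ?_
  · have h1 := setLIntegral_Ioo_sub (fun x => ‖evenOp f x - c * absFrac (1 / 2) x‖ₑ)
      (1 / 2) b ((1 : ℤ) : ℝ)
    have h2 := setLIntegral_Ioo_sub (fun x => ‖f x - c‖ₑ) (4 - (1 - b)⁻¹) 2 ((4 : ℤ) : ℝ)
    have hd : EvenPeriodic (absFrac (1 / 2)) := absFrac_half_idem
    simp only [(evenPeriodic_evenOp f).int_sub, hd.int_sub] at h1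
    simp only [hf.int_sub] at h2
    rw [h1, h2]
    refine (le_of_eq ?_).trans ((setLIntegral_evenOp_sub_le f c (a := 1 - b) (b := 1 / 2)
      (by linarith) (by norm_num) le_rfl).trans (le_of_eq ?_))
    · norm_num
    · norm_num
  · refine (setLIntegral_evenOp_sub_le f c ha (by norm_num) le_rfl).trans (le_of_eq ?_)
    norm_num

theorem OscControl.setLIntegral_evenOp_le {f : ℝ → ℝ} {r A : ℝ} (hf : OscControl f r A) {t : ℝ}
    (ht0 : 0 < t) (ht1 : t < 1) :
    ∫⁻ x in Ioo 0 t, ‖evenOp f x‖ₑ ≤ ENNReal.ofReal (5 * t ^ 2 * A) := by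
  refine (hf.evenPeriodic.setLIntegral_evenOp_le_sq ht0 ht1).trans ?_
  rw [ENNReal.ofReal_mul (p := 5 * t ^ 2) (by positivity)]
  gcongr
  exact hf.l1

theorem OscControl.oscLE_evenOp_left {f : ℝ → ℝ} {r A : ℝ} (hf : OscControl f r A) {a b : ℝ}
    (hab : a < b) (hab' : b - a ≤ 1 / 4) (ha : 0 ≤ a) (hs : a + b ≤ 1) :
    OscLE (evenOp f) (3 / 4 * r + 200 * A) a b := by
  have hr := hf.nonneg_osc
  have hA := hf.nonneg_l1
  have hba : 0 < b - a := sub_pos.2 hab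
  have hb0 : 0 < b := ha.trans_lt hab
  rcases le_or_gt (a ^ 2 / 4) (b - a) with hcr | hcr
  · refine oscLE_of_setLIntegral_le ?_
    refine (lintegral_mono_set (Ioo_subset_Ioo_left ha)).trans
      ((hf.setLIntegral_evenOp_le hb0 (by linarith)).trans (ENNReal.ofReal_le_ofReal ?_))
    -- If b ≤ 2a, then b² ≤ 4a² ≤ 16(b - a). Otherwise b < 2(b - a), and b ≤ 1.
    have hb2 : 5 * b ^ 2 ≤ 200 * (b - a) := by
      rcases le_or_gt b (2 * a) with h | h
      · nlinarith
      · nlinarith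
    have h3 : 0 ≤ r * (b - a) := by positivity
    nlinarith [mul_le_mul_of_nonneg_right hb2 hA]
  have ha0 : 0 < a := by
    rcases ha.eq_or_lt with h | h
    · rw [← h] at hcr hba
      linarith
    · exact h
  rcases le_or_gt b (1 / 2) with hb2 | hb2
  · have e : a⁻¹ - b⁻¹ = (b - a) / (a * b) := by
      field_simp
    have hsmall : a⁻¹ - b⁻¹ ≤ 1 / 4 := by
      rw [e, div_le_iff₀ (by positivity)]
      nlinarith
    refine hf.oscLE_evenOp_of_image (p := b⁻¹) (q := a⁻¹) (m := a) (M := b) hab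
      ((inv_lt_inv₀ hb0 ha0).2 hab) hsmall ha0 hab.le hb2 (fun x hx => ?_) le_rfl ?_ ?_
      fun c => setLIntegral_evenOp_sub_le f c ha0 hb0 hb2
    · rw [absFrac_half_of_mem (by linarith [hx.1]) (by linarith [hx.2])]
      exact ⟨hx.1.le, hx.2.le⟩
    · rw [e, mul_div_assoc', div_le_iff₀ (by positivity)]
      nlinarith [mul_pos ha0 hba]
    · rw [e, mul_div_assoc', le_div_iff₀ (by positivity)]
      nlinarith [mul_pos hb0 hba]
  · have ha2 : a < 1 / 2 := by linarith
    have ia : a * a⁻¹ = 1 := mul_inv_cancel₀ ha0.ne'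
    have ib : (1 - b) * (1 - b)⁻¹ = 1 := mul_inv_cancel₀ (by linarith)
    have la : 2 < a⁻¹ := by
      rw [lt_inv_comm₀ two_pos ha0]
      linarith
    have lb : 2 < (1 - b)⁻¹ := by
      rw [lt_inv_comm₀ two_pos (by linarith)]
      linarith
    have lab : (1 - b)⁻¹ ≤ a⁻¹ := inv_anti₀ ha0 (by linarith)
    set u := a⁻¹ with hu
    set v := (1 - b)⁻¹ with hv
    -- The length is (u - 2) + (v - 2), rewritten with au = 1 and (1-b)v = 1.
    have hq : u - (4 - v) = 2 * ((1 / 2 - a) * u + (b - 1 / 2) * v) := by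
      linear_combination 2 * ia + 2 * ib
    have h1 : a ^ 2 * (u - (4 - v)) ≤ b - a := by
      have e1 : (1 / 2 - a) * u + (b - 1 / 2) * v ≤ (b - a) * u := by
        nlinarith
      calc a ^ 2 * (u - (4 - v)) ≤ a ^ 2 * (2 * ((b - a) * u)) := by
            rw [hq]
            gcongr
        _ = 2 * a * (b - a) * (a * u) := by ring
        _ ≤ b - a := by
            rw [ia]
            nlinarith
    have h2 : b - a ≤ (1 / 2) ^ 2 * (u - (4 - v)) := by
      rw [hq]
      nlinarith
    refine hf.oscLE_evenOp_of_image (p := 4 - v) (q := u) (m := a) (M := 1 / 2) hab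
      (by linarith) ?_ ha0 ha2.le le_rfl (fun x hx => absFrac_half_mem_Icc ha hs hx)
      (by linarith) h1 h2
      fun c => setLIntegral_evenOp_sub_le_of_half_lt hf.evenPeriodic c ha0 ha2 hb2 (by linarith)
    have h3 : a ^ 2 * (u - (4 - v)) ≤ a ^ 2 * (1 / 4) := by linarith
    exact le_of_mul_le_mul_left h3 (by positivity)

theorem OscControl.oscLE_evenOp {f : ℝ → ℝ} {r A : ℝ} (hf : OscControl f r A) {a b : ℝ}
    (hab : a < b) (hab' : b - a ≤ 1 / 4) : OscLE (evenOp f) (3 / 4 * r + 200 * A) a b := by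
  have hF := evenPeriodic_evenOp f
  have hr := hf.nonneg_osc
  have hA := hf.nonneg_l1
  have h1 := Int.floor_le a
  have h2 := Int.lt_floor_add_one a
  rcases le_or_gt b (⌊a⌋ + 1) with hb | hb
  · refine hF.oscLE_add_int (-⌊a⌋) ?_
    push_cast
    rcases le_or_gt (a + -⌊a⌋ + (b + -⌊a⌋)) 1 with hs | hs
    · exact hf.oscLE_evenOp_left (by linarith) (by linarith) (by linarith) hs
    · refine hF.oscLE_int_sub 1 ?_
      push_cast
      exact hf.oscLE_evenOp_left (by linarith) (by linarith) (by linarith) (by linarith)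
  -- The interval crosses an integer, which is moved to 0. There the quadratic L¹ bound on either
  -- side is enough.
  · refine hF.oscLE_add_int (-(⌊a⌋ + 1)) ?_
    push_cast
    set s : ℝ := a + -(⌊a⌋ + 1)
    set t : ℝ := b + -(⌊a⌋ + 1)
    have hs : s < 0 := by
      simp only [s]
      linarith
    have ht : 0 < t := by
      simp only [t]
      linarith
    have hst : t - s ≤ 1 / 4 := by
      simp only [s, t]
      linarith
    refine oscLE_of_setLIntegral_le ?_
    have e := setLIntegral_Ioo_sub (fun x => ‖evenOp f x‖ₑ) s 0 ((0 : ℤ) : ℝ)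
    simp only [Int.cast_zero, zero_sub, neg_zero, hF.neg] at e
    rw [setLIntegral_Ioo_split _ hs ht, e]
    refine (add_le_add (hf.setLIntegral_evenOp_le (t := -s) (by linarith) (by linarith))
      (hf.setLIntegral_evenOp_le ht (by linarith))).trans ?_
    rw [← ENNReal.ofReal_add (by positivity) (by positivity)]
    refine ENNReal.ofReal_le_ofReal ?_
    have h3 : 0 ≤ r * (t - s) := mul_nonneg hr (by linarith)
    have h4 : 5 * (-s) ^ 2 + 5 * t ^ 2 ≤ 200 * (t - s) := by nlinarith
    nlinarith [mul_le_mul_of_nonneg_right h4 hA]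

theorem OscControl.evenOp {f : ℝ → ℝ} {r A : ℝ} (hf : OscControl f r A) :
    OscControl (evenOp f) (3 / 4 * r + 200 * A) (A / 2) where
  aemeasurable := evenOp_aemeasurable hf.aemeasurable
  evenPeriodic := evenPeriodic_evenOp f
  nonneg_osc := by
    have := hf.nonneg_osc
    have := hf.nonneg_l1
    positivity
  nonneg_l1 := by
    have := hf.nonneg_l1
    positivity
  osc _ _ hab hab' := hf.oscLE_evenOp hab hab'
  l1 := by
    refine hf.evenPeriodic.halfL1_evenOp_le.trans ?_
    rw [show A / 2 = 1 / 2 * A by ring, ENNReal.ofReal_mul (p := 1 / 2) (by norm_num)]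
    gcongr
    exact hf.l1

/-- The quantity r + wA shrinks by 3/4 as soon as 200 + w/2 ≤ 3w/4, that is w ≥ 800. -/
theorem OscControl.iterate_evenOp {f : ℝ → ℝ} {r A : ℝ} (hf : OscControl f r A) (n : ℕ) :
    ∃ r' A', OscControl (Brjuno.evenOp^[n] f) r' A' ∧
      r' + 1000 * A' ≤ (3 / 4) ^ n * (r + 1000 * A) := by
  induction n with
  | zero => exact ⟨r, A, hf, by simp⟩
  | succ n ih =>
    obtain ⟨r', A', h, hle⟩ := ih
    rw [Function.iterate_succ_apply']
    refine ⟨_, _, h.evenOp, ?_⟩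
    have := h.nonneg_l1
    rw [pow_succ']
    linarith

/-! ### Oscillation control versus the norm of `XStar` -/

theorem setLIntegral_Ioo_enorm {f : ℝ → ℝ} {a b : ℝ} (hab : a ≤ b)
    (hf : IntervalIntegrable f volume a b) :
    ∫⁻ x in Ioo a b, ‖f x‖ₑ = ENNReal.ofReal (∫ x in a..b, |f x|) := by
  have h : IntegrableOn f (Ioo a b) volume :=
    ((intervalIntegrable_iff_integrableOn_Ioc_of_le hab).1 hf).mono_set Ioo_subset_Ioc_self
  rw [intervalIntegral.integral_of_le hab, integral_Ioc_eq_integral_Ioo]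
  exact (ofReal_integral_norm_eq_lintegral_enorm h).symm

theorem intervalIntegral_abs_le {f : ℝ → ℝ} {a b R : ℝ} (hab : a ≤ b) (hR : 0 ≤ R)
    (hf : IntervalIntegrable f volume a b)
    (h : ∫⁻ x in Ioo a b, ‖f x‖ₑ ≤ ENNReal.ofReal R) : ∫ x in a..b, |f x| ≤ R := by
  rw [setLIntegral_Ioo_enorm hab hf] at h
  exact (ENNReal.ofReal_le_ofReal_iff hR).1 h

/-- The mean differs from c by at most R/(b - a), whence the factor 2. -/
theorem meanOsc_le_of_setLIntegral_le {f : ℝ → ℝ} (hf : LocallyIntegrable f volume)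
    {a b c R : ℝ} (hab : a < b) (hR : 0 ≤ R)
    (h : ∫⁻ x in Ioo a b, ‖f x - c‖ₑ ≤ ENNReal.ofReal R) :
    meanOsc f a b ≤ 2 * R / (b - a) := by
  have hba : 0 < b - a := sub_pos.2 hab
  have hfi := intervalIntegrable_of_loc hf a b
  have hfc : ∀ k : ℝ, IntervalIntegrable (fun x => f x - k) volume a b :=
    fun k => hfi.sub intervalIntegrable_const
  have h1 := intervalIntegral_abs_le hab.le hR (hfc c) h
  have h2 : |intervalMean f a b - c| * (b - a) ≤ R := by
    have e : (intervalMean f a b - c) * (b - a) = ∫ x in a..b, (f x - c) := by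
      rw [intervalIntegral.integral_sub hfi intervalIntegrable_const,
        intervalIntegral.integral_const, smul_eq_mul]
      unfold intervalMean
      field_simp
    rw [← abs_of_pos hba, ← abs_mul, e]
    exact (intervalIntegral.abs_integral_le_integral_abs hab.le).trans h1
  have h3 : ∫ x in a..b, |f x - intervalMean f a b| ≤ 2 * R := by
    calc ∫ x in a..b, |f x - intervalMean f a b|
        ≤ ∫ x in a..b, (|f x - c| + |intervalMean f a b - c|) := by
          refine intervalIntegral.integral_mono_on hab.le (hfc _).abs
            ((hfc c).abs.add intervalIntegrable_const) fun x _ => ?_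
          rw [abs_sub_comm (intervalMean f a b) c]
          exact abs_sub_le _ _ _
      _ = (∫ x in a..b, |f x - c|) + |intervalMean f a b - c| * (b - a) := by
          rw [intervalIntegral.integral_add (hfc c).abs intervalIntegrable_const,
            intervalIntegral.integral_const, smul_eq_mul, mul_comm (b - a)]
      _ ≤ 2 * R := by linarith
  unfold meanOsc
  nth_rw 1 [intervalMean]
  rw [← div_eq_inv_mul]
  gcongr

theorem OscControl.locallyIntegrable {f : ℝ → ℝ} {r A : ℝ} (hf : OscControl f r A) :
    LocallyIntegrable f volume := fun x => by
  refine ⟨Ioo (x - 1 / 2) (x + 1 / 2), Ioo_mem_nhds (by linarith) (by linarith),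
    hf.aemeasurable.aestronglyMeasurable.restrict, ?_⟩
  exact (hf.setLIntegral_le (by linarith)).trans_lt ENNReal.ofReal_lt_top

theorem OscControl.meanOsc_le {f : ℝ → ℝ} {r A : ℝ} (hf : OscControl f r A) {a b : ℝ}
    (hab : a < b) (hab' : b - a < 1) : meanOsc f a b ≤ 2 * r + 32 * A := by
  have hr := hf.nonneg_osc
  have hA := hf.nonneg_l1
  have hba : 0 < b - a := sub_pos.2 hab
  rcases le_or_gt (b - a) (1 / 4) with h | h
  · obtain ⟨c, hc⟩ := hf.osc a b hab h
    refine (meanOsc_le_of_setLIntegral_le hf.locallyIntegrable hab (by positivity) hc).trans ?_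
    rw [← mul_assoc, mul_div_assoc, div_self hba.ne']
    linarith
  -- Over lengths above 1/4 the L¹ norm decides: 2 · 4A / (1/4) = 32A.
  · have hc : ∫⁻ x in Ioo a b, ‖f x - 0‖ₑ ≤ ENNReal.ofReal (4 * A) := by
      simpa only [sub_zero] using hf.setLIntegral_le hab'.le
    refine (meanOsc_le_of_setLIntegral_le hf.locallyIntegrable hab (by positivity) hc).trans ?_
    rw [div_le_iff₀ hba]
    nlinarith

theorem OscControl.memXStar {f : ℝ → ℝ} {r A : ℝ} (hf : OscControl f r A) : MemXStar f := by
  refine ⟨⟨hf.locallyIntegrable, 2 * r + 32 * A, ?_⟩,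
    Filter.Eventually.of_forall fun x => ?_, Filter.Eventually.of_forall hf.evenPeriodic.neg⟩
  · rintro _ ⟨a, b, hab, hab', rfl⟩
    exact hf.meanOsc_le hab hab'
  · simpa using hf.evenPeriodic.add_int x 1

theorem OscControl.xStarNorm_le {f : ℝ → ℝ} {r A : ℝ} (hf : OscControl f r A) :
    xStarNorm f ≤ 2 * (r + 1000 * A) := by
  have hA := hf.nonneg_l1
  have h1 : bmoSeminorm f ≤ 2 * r + 32 * A := by
    refine csSup_le (oscSet_nonempty f) ?_
    rintro _ ⟨a, b, hab, hab', rfl⟩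
    exact hf.meanOsc_le hab hab'
  have h2 := intervalIntegral_abs_le (by norm_num) hA
    (intervalIntegrable_of_loc hf.locallyIntegrable 0 (1 / 2)) hf.l1
  unfold xStarNorm
  linarith

/-- Converse of `OscControl.xStarNorm_le`: the norm serves as both r and A, for the exactly even and
periodic representative. -/
theorem MemXStar.oscControl {f : ℝ → ℝ} (hf : MemXStar f) :
    OscControl (fun x => f (absFrac (1 / 2) x)) (xStarNorm f) (xStarNorm f) := by
  have hae := comp_absFrac_half_ae_eq hf.2.1 hf.2.2
  have h0 : 0 ≤ ∫ x in (0 : ℝ)..(1 / 2), |f x| :=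
    intervalIntegral.integral_nonneg (by norm_num) fun _ _ => abs_nonneg _
  have h0' := bmoSeminorm_nonneg f
  have hn : 0 ≤ xStarNorm f := add_nonneg h0 h0'
  refine ⟨hf.1.1.aestronglyMeasurable.aemeasurable.congr hae.symm,
    fun x => by simp only [absFrac_half_idem], hn, hn, fun a b hab hab' => ?_, ?_⟩
  · refine ⟨intervalMean f a b, ?_⟩
    have e : ∫⁻ x in Ioo a b, ‖f (absFrac (1 / 2) x) - intervalMean f a b‖ₑ =
        ∫⁻ x in Ioo a b, ‖f x - intervalMean f a b‖ₑ :=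
      lintegral_congr_ae (ae_restrict_of_ae (hae.mono fun x hx => by simp only [hx]))
    have hba : 0 < b - a := sub_pos.2 hab
    have hm : meanOsc f a b ≤ bmoSeminorm f :=
      le_csSup hf.1.2 ⟨a, b, hab, by linarith, rfl⟩
    rw [e, setLIntegral_Ioo_enorm hab.le
      ((intervalIntegrable_of_loc hf.1.1 a b).sub intervalIntegrable_const)]
    refine ENNReal.ofReal_le_ofReal ?_
    have e2 : ∫ x in a..b, |f x - intervalMean f a b| = meanOsc f a b * (b - a) := by
      change _ = ((b - a)⁻¹ * ∫ x in a..b, |f x - intervalMean f a b|) * (b - a)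
      rw [mul_comm, ← mul_assoc, mul_inv_cancel₀ hba.ne', one_mul]
    rw [e2]
    gcongr
    unfold xStarNorm
    linarith
  · have e : halfL1 (fun x => f (absFrac (1 / 2) x)) = halfL1 f :=
      lintegral_congr_ae (ae_restrict_of_ae (hae.mono fun x hx => by simp only [hx]))
    rw [e, halfL1, setLIntegral_Ioo_enorm (by norm_num) (intervalIntegrable_of_loc hf.1.1 _ _)]
    refine ENNReal.ofReal_le_ofReal ?_
    unfold xStarNorm
    linarith

/-! ### Sums of functions with controlled oscillation -/

theorem ae_summable_of_tsum_lintegral_ne_top {s : Set ℝ} {f : ℕ → ℝ → ℝ}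
    (hf : ∀ i, AEMeasurable (f i) volume) (h : ∑' i, ∫⁻ x in s, ‖f i x‖ₑ ≠ ∞) :
    ∀ᵐ x ∂(volume.restrict s), Summable fun i => f i x := by
  rw [← lintegral_tsum fun i => (hf i).restrict.enorm] at h
  filter_upwards [ae_lt_top' (AEMeasurable.tsum fun i => (hf i).restrict.enorm) h] with x hx
  refine Summable.of_enorm ?_
  exact hx.ne

theorem enorm_tsum_le (u : ℕ → ℝ) : ‖∑' i, u i‖ₑ ≤ ∑' i, ‖u i‖ₑ := by
  by_cases h : Summable u
  · rw [enorm_eq_nnnorm]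
    simp only [enorm_eq_nnnorm]
    by_cases h' : Summable fun i => ‖u i‖₊
    · rw [← ENNReal.coe_tsum h']
      exact_mod_cast nnnorm_tsum_le h'
    · rw [ENNReal.tsum_coe_eq_top_iff_not_summable_coe.2 (by exact_mod_cast h')]
      exact le_top
  · rw [tsum_eq_zero_of_not_summable h]
    simp

/-- For a fixed interval the approximating constants are summable by `OscControl.abs_const_le`, and
their sum approximates the sum of the functions. -/
theorem oscControl_tsum {f : ℕ → ℝ → ℝ} {r A : ℕ → ℝ} (hf : ∀ i, OscControl (f i) (r i) (A i))
    (hr : Summable r) (hA : Summable A) :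
    (∀ᵐ x ∂(volume : Measure ℝ), Summable fun i => f i x) ∧
      OscControl (fun x => ∑' i, f i x) (∑' i, r i) (∑' i, A i) := by
  have hr0 := fun i => (hf i).nonneg_osc
  have hA0 := fun i => (hf i).nonneg_l1
  have hmeas := fun i => (hf i).aemeasurable
  have hloc : ∀ a b : ℝ, b - a ≤ 1 →
      ∀ᵐ x ∂(volume.restrict (Ioo a b)), Summable fun i => f i x := by
    intro a b hab
    refine ae_summable_of_tsum_lintegral_ne_top hmeas (ne_top_of_le_ne_top ?_
      (ENNReal.tsum_le_tsum fun i => (hf i).setLIntegral_le hab))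
    rw [← ENNReal.ofReal_tsum_of_nonneg (fun i => mul_nonneg (by norm_num) (hA0 i))
      (hA.mul_left 4)]
    exact ENNReal.ofReal_ne_top
  have hsum : ∀ᵐ x ∂(volume : Measure ℝ), Summable fun i => f i x := by
    have h : ∀ᵐ x ∂(volume : Measure ℝ), ∀ n : ℤ, x ∈ Ioo ((n : ℝ) / 2) (n / 2 + 1) →
        Summable fun i => f i x := by
      rw [ae_all_iff]
      exact fun n => (ae_restrict_iff' measurableSet_Ioo).1 (hloc _ _ (by linarith))
    filter_upwards [h] with x hx
    have h1 := Int.ceil_lt_add_one (2 * x)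
    have h2 := Int.le_ceil (2 * x)
    -- With the ceiling, x lies strictly inside the interval even when 2x is an integer.
    refine hx (⌈2 * x⌉ - 1) ⟨?_, ?_⟩ <;> push_cast <;> linarith
  refine ⟨hsum, ?_, fun x => by simp only [(hf _).evenPeriodic x], tsum_nonneg hr0,
    tsum_nonneg hA0, fun a b hab hab' => ?_, ?_⟩
  · exact AEMeasurable.tsum hmeas
  · have hba : 0 < b - a := sub_pos.2 hab
    choose c hc using fun i => (hf i).osc a b hab hab'
    have hcs : Summable c := by
      refine Summable.of_norm_bounded (g := fun i => (4 * A i + r i * (b - a)) / (b - a))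
        (((hA.mul_left 4).add (hr.mul_right _)).div_const _) fun i => ?_
      rw [le_div_iff₀ hba]
      exact (hf i).abs_const_le (by linarith) (mul_nonneg (hr0 i) hba.le) (hc i)
    refine ⟨∑' i, c i, ?_⟩
    calc ∫⁻ x in Ioo a b, ‖∑' i, f i x - ∑' i, c i‖ₑ
        ≤ ∫⁻ x in Ioo a b, ∑' i, ‖f i x - c i‖ₑ := by
          refine lintegral_mono_ae (ae_restrict_of_ae ?_)
          filter_upwards [hsum] with x hx
          rw [← hx.tsum_sub hcs]
          exact enorm_tsum_le _
      _ = ∑' i, ∫⁻ x in Ioo a b, ‖f i x - c i‖ₑ :=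
          lintegral_tsum fun i => ((hmeas i).sub_const _).restrict.enorm
      _ ≤ ∑' i, ENNReal.ofReal (r i * (b - a)) := ENNReal.tsum_le_tsum hc
      _ = ENNReal.ofReal ((∑' i, r i) * (b - a)) := by
          rw [← ENNReal.ofReal_tsum_of_nonneg (fun i => mul_nonneg (hr0 i) hba.le)
            (hr.mul_right _), tsum_mul_right]
  · calc halfL1 (fun x => ∑' i, f i x) ≤ ∫⁻ x in Ioo (0 : ℝ) (1 / 2), ∑' i, ‖f i x‖ₑ :=
          lintegral_mono fun x => enorm_tsum_le _
      _ = ∑' i, ∫⁻ x in Ioo (0 : ℝ) (1 / 2), ‖f i x‖ₑ :=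
          lintegral_tsum fun i => (hmeas i).restrict.enorm
      _ ≤ ∑' i, ENNReal.ofReal (A i) := ENNReal.tsum_le_tsum fun i => (hf i).l1
      _ = ENNReal.ofReal (∑' i, A i) := (ENNReal.ofReal_tsum_of_nonneg hA0 hA).symm

/-- The Neumann series `∑ₙ Tⁿ f` of the operator `T = evenOp`. -/
def neumann (f : ℝ → ℝ) (x : ℝ) : ℝ := ∑' n : ℕ, evenOp^[n] f x

theorem OscControl.neumann {f : ℝ → ℝ} {r A : ℝ} (hf : OscControl f r A) :
    (∀ᵐ x ∂(volume : Measure ℝ), Summable fun n : ℕ => Brjuno.evenOp^[n] f x) ∧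
    (∃ r' A', OscControl (neumann f) r' A' ∧ r' + 1000 * A' ≤ 4 * (r + 1000 * A)) ∧
      neumann f =ᵐ[volume] fun x => f x + Brjuno.evenOp (Brjuno.neumann f) x := by
  choose r' A' h hle using hf.iterate_evenOp
  have hV : 0 ≤ r + 1000 * A := by
    have := hf.nonneg_osc
    have := hf.nonneg_l1
    positivity
  have hg : HasSum (fun n : ℕ => (3 / 4 : ℝ) ^ n * (r + 1000 * A)) (4 * (r + 1000 * A)) := by
    have := (hasSum_geometric_of_lt_one (r := (3 / 4 : ℝ)) (by norm_num) (by norm_num)).mul_right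
      (r + 1000 * A)
    norm_num at this
    exact this
  have hr0 := fun i => (h i).nonneg_osc
  have hA0 := fun i => (h i).nonneg_l1
  have hrs : Summable r' := Summable.of_nonneg_of_le hr0
    (fun i => by linarith [hle i, hA0 i]) hg.summable
  have hAs : Summable A' := Summable.of_nonneg_of_le hA0
    (fun i => by linarith [hle i, hA0 i, hr0 i]) hg.summable
  obtain ⟨hs, hc⟩ := oscControl_tsum h hrs hAs
  refine ⟨hs, ⟨_, _, hc, ?_⟩, ?_⟩
  · rw [← tsum_mul_left, ← hrs.tsum_add (hAs.mul_left _), ← hg.tsum_eq]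
    exact (hrs.add (hAs.mul_left _)).tsum_le_tsum hle hg.summable
  · filter_upwards [hs] with x hx
    unfold Brjuno.neumann
    rw [hx.tsum_eq_zero_add]
    congr 1
    -- The operator evaluates at one point and multiplies by a number, so it passes through the
    -- pointwise sum without any convergence assumption at that point.
    unfold Brjuno.evenOp
    rw [← tsum_mul_left]
    simp only [Function.iterate_succ_apply']

/-! ### The logarithm -/

/-- This is log z ≤ z - 1 at z = M/u. It also bounds the error of one α-step below. -/
theorem mul_log_sub_log_le {u M : ℝ} (hu : 0 < u) (hM : 0 < M) :
    u * (Real.log M - Real.log u) ≤ M - u := by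
  have h := Real.log_le_sub_one_of_pos (div_pos hM hu)
  rw [Real.log_div hM.ne' hu.ne'] at h
  calc u * (Real.log M - Real.log u) ≤ u * (M / u - 1) := by gcongr
    _ = M - u := by field_simp

/-- Subtracting log at the end point farthest from 0 gives an integrand of one sign, so the integral
is explicit. -/
theorem oscLE_log {a b : ℝ} (hab : a < b) : OscLE (fun x => -Real.log x) 2 a b := by
  set M := max |a| |b| with hMdef
  have haM : |a| ≤ M := le_max_left _ _
  have hbM : |b| ≤ M := le_max_right _ _
  have hM : 0 < M := by
    rcases eq_or_ne a 0 with h | h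
    · exact (abs_pos.2 (by linarith : b ≠ 0)).trans_le hbM
    · exact (abs_pos.2 h).trans_le haM
  refine ⟨-Real.log M, ?_⟩
  have hlog : IntervalIntegrable Real.log volume a b := intervalIntegral.intervalIntegrable_log'
  have hsub : IntervalIntegrable (fun x => -Real.log x - -Real.log M) volume a b :=
    hlog.neg.sub intervalIntegrable_const
  rw [setLIntegral_Ioo_enorm hab.le hsub]
  refine ENNReal.ofReal_le_ofReal ?_
  have e : ∫ x in a..b, |-Real.log x - -Real.log M| = ∫ x in a..b, (Real.log M - Real.log x) := by
    refine intervalIntegral.integral_congr_ae ?_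
    filter_upwards [Measure.ae_ne volume (0 : ℝ)] with x hx0 hx
    rw [uIoc_of_le hab.le] at hx
    have hxM : |x| ≤ M := abs_le.2
      ⟨by linarith [neg_abs_le a, hx.1], by linarith [le_abs_self b, hx.2]⟩
    have h : Real.log x ≤ Real.log M := by
      rw [← Real.log_abs x]
      exact Real.log_le_log (abs_pos.2 hx0) hxM
    rw [abs_of_nonneg (by linarith)]
    ring
  rw [e, intervalIntegral.integral_sub intervalIntegrable_const hlog, integral_log,
    intervalIntegral.integral_const, smul_eq_mul]
  rcases le_or_gt 0 a with ha | ha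
  · have hMb : M = b := by
      rw [hMdef, abs_of_nonneg ha, abs_of_pos (by linarith), max_eq_right hab.le]
    rw [hMb]
    rcases ha.eq_or_lt with h | h
    · rw [← h]
      simp only [sub_zero, zero_mul]
      linarith
    · have := mul_le_mul_of_nonneg_left (Real.log_le_log h hab.le) ha
      linarith
  rcases le_or_gt b 0 with hb | hb
  · have hMa : M = -a := by
      rw [hMdef, abs_of_neg ha, abs_of_nonpos hb, max_eq_left (by linarith)]
    rw [hMa, Real.log_neg_eq_log]
    rcases hb.eq_or_lt with h | h
    · rw [h]
      simp only [zero_sub, zero_mul]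
      linarith
    · have h1 : Real.log b ≤ Real.log a := by
        rw [← Real.log_neg_eq_log b, ← Real.log_neg_eq_log a]
        exact Real.log_le_log (by linarith) (by linarith)
      have := mul_le_mul_of_nonneg_left h1 (neg_nonneg.2 hb)
      linarith
  -- With 0 inside, the two logarithmic terms add at most (M - b) + (M + a) to b - a; the total is
  -- at most 2M.
  · have h1 := mul_log_sub_log_le hb hM
    have h2 := mul_log_sub_log_le (neg_pos.2 ha) hM
    rw [Real.log_neg_eq_log] at h2
    have h3 : M ≤ b - a := by
      rw [abs_of_neg ha] at haM
      rw [hMdef, abs_of_neg ha, abs_of_pos hb]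
      exact max_le (by linarith) (by linarith)
    linarith

theorem evenPeriodic_evenNegLog : EvenPeriodic evenNegLog := fun x => by
  unfold evenNegLog
  rw [absFrac_half_idem]

theorem evenNegLog_of_abs_le {x : ℝ} (hx : |x| ≤ 1 / 2) : evenNegLog x = -Real.log x := by
  have h : evenNegLog |x| = evenNegLog x := by
    rcases abs_choice x with h | h <;> rw [h]
    exact evenPeriodic_evenNegLog.neg x
  rw [← h, evenNegLog, absFrac_half_of_mem (abs_nonneg x) hx, Real.log_abs]

theorem oscLE_evenNegLog {a b : ℝ} (hab : a < b) (hab' : b - a ≤ 1 / 4) :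
    OscLE evenNegLog 2 a b := by
  refine evenPeriodic_evenNegLog.oscLE_add_int (-round a) ?_
  push_cast
  have hr := abs_le.1 (abs_sub_round a)
  set s := a + -(round a : ℝ) with hs
  set t := b + -(round a : ℝ) with ht
  have hst : s < t := by linarith
  have hst' : t - s ≤ 1 / 4 := by linarith
  have hs1 : -(1 / 2) ≤ s := by linarith [hr.1]
  rcases le_or_gt t (1 / 2) with h | h
  · obtain ⟨c, hc⟩ := oscLE_log hst
    refine ⟨c, le_trans (le_of_eq ?_) hc⟩
    refine setLIntegral_congr_fun measurableSet_Ioo fun x hx => ?_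
    have := evenNegLog_of_abs_le (x := x) (abs_le.2 ⟨by linarith [hx.1], by linarith [hx.2]⟩)
    simp only [this]
  -- The interval now lies in (1/4, 3/4), where |ℓ| ≤ log 4 < 2.
  · refine oscLE_of_setLIntegral_le ?_
    rw [ENNReal.ofReal_mul zero_le_two, ← Real.volume_Ioo, ← setLIntegral_const]
    refine setLIntegral_mono' measurableSet_Ioo fun x hx => ?_
    rw [Real.enorm_eq_ofReal_abs]
    refine ENNReal.ofReal_le_ofReal ?_
    have hd := absFrac_half_mem_Icc (a := 1 / 4) (b := 3 / 4) (x := x) (by norm_num) (by norm_num)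
      ⟨by linarith [hx.1, hr.2], by linarith [hx.2, hr.2]⟩
    have hl : -Real.log 4 ≤ Real.log (absFrac (1 / 2) x) := by
      rw [← Real.log_inv]
      exact Real.log_le_log (by norm_num) (by linarith [hd.1])
    have hl' : Real.log (absFrac (1 / 2) x) ≤ 0 :=
      Real.log_nonpos (absFrac_half_nonneg x) (by linarith [hd.2])
    have h4 : Real.log 4 ≤ 2 := by
      rw [show (4 : ℝ) = 2 ^ 2 by norm_num, Real.log_pow]
      have := Real.log_two_lt_d9
      push_cast
      linarith
    unfold evenNegLog
    rw [abs_neg, abs_of_nonpos hl']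
    linarith

theorem exists_oscControl_evenNegLog : ∃ A, OscControl evenNegLog 2 A := by
  have hfin : halfL1 evenNegLog ≠ ∞ := by
    have e : halfL1 evenNegLog = ∫⁻ x in Ioo (0 : ℝ) (1 / 2), ‖-Real.log x‖ₑ := by
      refine setLIntegral_congr_fun measurableSet_Ioo fun x hx => ?_
      simp only [evenNegLog_of_abs_le (abs_le.2 ⟨by linarith [hx.1], hx.2.le⟩)]
    have hlog : IntervalIntegrable (fun x => -Real.log x) volume 0 (1 / 2) :=
      intervalIntegral.intervalIntegrable_log'.neg
    rw [e, setLIntegral_Ioo_enorm (by norm_num) hlog]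
    exact ENNReal.ofReal_ne_top
  exact ⟨(halfL1 evenNegLog).toReal,
    (Real.measurable_log.comp (measurable_absFrac _)).neg.aemeasurable, evenPeriodic_evenNegLog,
    zero_le_two, ENNReal.toReal_nonneg, fun a b => oscLE_evenNegLog,
    (ENNReal.ofReal_toReal hfin).ge⟩

/-! ### The operator on `X_*` -/

theorem XStar.coe_ofFun_ae_eq {f : ℝ → ℝ} (hf : MemXStar f) :
    ((XStar.ofFun f hf : XStar) : ℝ →ₘ[volume] ℝ) =ᵐ[volume] f :=
  AEEqFun.coeFn_mk f hf.1.1.aestronglyMeasurable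

theorem XStar.norm_ofFun {f : ℝ → ℝ} (hf : MemXStar f) : ‖XStar.ofFun f hf‖ = xStarNorm f :=
  xStarNorm_congr (XStar.coe_ofFun_ae_eq hf)

theorem XStar.ext_ae {f g : XStar}
    (h : (f : ℝ →ₘ[volume] ℝ) =ᵐ[volume] (g : ℝ →ₘ[volume] ℝ)) : f = g :=
  Subtype.ext (AEEqFun.ext h)

/-- The exactly even and periodic representative of an element of `X_*`. -/
def XStar.rep (f : XStar) (x : ℝ) : ℝ := (f : ℝ →ₘ[volume] ℝ) (absFrac (1 / 2) x)

theorem XStar.memXStar (f : XStar) : MemXStar (f : ℝ →ₘ[volume] ℝ) := f.2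

theorem XStar.rep_ae_eq (f : XStar) : (XStar.rep f) =ᵐ[volume] (f : ℝ →ₘ[volume] ℝ) :=
  comp_absFrac_half_ae_eq (XStar.memXStar f).2.1 (XStar.memXStar f).2.2

theorem XStar.oscControl_rep (f : XStar) : OscControl (XStar.rep f) ‖f‖ ‖f‖ :=
  (XStar.memXStar f).oscControl

theorem XStar.memXStar_evenOp (f : XStar) : MemXStar (evenOp (f : ℝ →ₘ[volume] ℝ)) :=
  memXStar_congr (evenOp_congr (XStar.rep_ae_eq f)) (XStar.oscControl_rep f).evenOp.memXStar

/-- The operator `T_e` as a bounded operator of `X_*`. -/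
def evenOpCLM : XStar →L[ℝ] XStar :=
  LinearMap.mkContinuous
    { toFun := fun f => XStar.ofFun _ (XStar.memXStar_evenOp f)
      map_add' := fun f g => by
        refine XStar.ext_ae ?_
        filter_upwards [XStar.coe_ofFun_ae_eq (XStar.memXStar_evenOp (f + g)),
          XStar.coe_ofFun_ae_eq (XStar.memXStar_evenOp f),
          XStar.coe_ofFun_ae_eq (XStar.memXStar_evenOp g),
          AEEqFun.coeFn_add (XStar.ofFun _ (XStar.memXStar_evenOp f) : ℝ →ₘ[volume] ℝ)
            (XStar.ofFun _ (XStar.memXStar_evenOp g) : ℝ →ₘ[volume] ℝ),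
          evenOp_congr (AEEqFun.coeFn_add (f : ℝ →ₘ[volume] ℝ) (g : ℝ →ₘ[volume] ℝ))]
          with x h1 h2 h3 h4 h5
        rw [h1, Submodule.coe_add, Submodule.coe_add, h4, h5, Pi.add_apply, h2, h3]
        exact mul_add _ _ _
      map_smul' := fun c f => by
        refine XStar.ext_ae ?_
        filter_upwards [XStar.coe_ofFun_ae_eq (XStar.memXStar_evenOp (c • f)),
          XStar.coe_ofFun_ae_eq (XStar.memXStar_evenOp f),
          AEEqFun.coeFn_smul c (XStar.ofFun _ (XStar.memXStar_evenOp f) : ℝ →ₘ[volume] ℝ),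
          evenOp_congr (AEEqFun.coeFn_smul c (f : ℝ →ₘ[volume] ℝ))] with x h1 h2 h3 h4
        rw [h1, RingHom.id_apply, Submodule.coe_smul, Submodule.coe_smul, h3, h4, Pi.smul_apply, h2]
        exact mul_left_comm _ _ _ }
    -- With r = A = ‖f‖ the bound is 2(3/4 + 200 + 500)‖f‖ = 1401.5 ‖f‖.
    1500 fun f => by
      have h := (XStar.oscControl_rep f).evenOp.xStarNorm_le
      rw [xStarNorm_congr (evenOp_congr (XStar.rep_ae_eq f)),
        ← XStar.norm_ofFun (XStar.memXStar_evenOp f)] at h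
      refine h.trans ?_
      have := norm_nonneg f
      linarith

theorem coe_evenOpCLM_ae_eq (f : XStar) {g : ℝ → ℝ}
    (h : g =ᵐ[volume] (f : ℝ →ₘ[volume] ℝ)) :
    (evenOpCLM f : ℝ →ₘ[volume] ℝ) =ᵐ[volume] evenOp g :=
  (XStar.coe_ofFun_ae_eq (XStar.memXStar_evenOp f)).trans (evenOp_congr h.symm)

theorem one_sub_evenOpCLM_eq {f g : XStar} {u v : ℝ → ℝ}
    (hu : (f : ℝ →ₘ[volume] ℝ) =ᵐ[volume] u) (hv : (g : ℝ →ₘ[volume] ℝ) =ᵐ[volume] v)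
    (h : u =ᵐ[volume] fun x => v x + evenOp u x) : (1 - evenOpCLM) f = g := by
  refine XStar.ext_ae ?_
  have e : (1 - evenOpCLM) f = f - evenOpCLM f := rfl
  rw [e, Submodule.coe_sub]
  filter_upwards [AEEqFun.coeFn_sub (f : ℝ →ₘ[volume] ℝ) (evenOpCLM f : ℝ →ₘ[volume] ℝ),
    coe_evenOpCLM_ae_eq f hu.symm, hu, hv, h] with x h1 h2 h3 h4 h5
  rw [h1, Pi.sub_apply, h2, h3, h4, h5, add_sub_cancel_right]

/-- The Neumann series is the preimage; 8008 = 2 · 4 · 1001, with r = A = ‖g‖ at the start. -/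
theorem exists_one_sub_evenOpCLM_eq (g : XStar) :
    ∃ f : XStar, (1 - evenOpCLM) f = g ∧ ‖f‖ ≤ 8008 * ‖g‖ := by
  obtain ⟨-, ⟨r, A, h, hle⟩, hae⟩ := (XStar.oscControl_rep g).neumann
  refine ⟨XStar.ofFun _ h.memXStar, one_sub_evenOpCLM_eq (XStar.coe_ofFun_ae_eq h.memXStar)
    (XStar.rep_ae_eq g).symm hae, ?_⟩
  rw [XStar.norm_ofFun]
  refine h.xStarNorm_le.trans ?_
  linarith

/-- A fixed vector equals all its iterates, whose norms decay like (3/4)ⁿ. -/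
theorem injective_one_sub_evenOpCLM :
    Function.Injective ⇑(1 - evenOpCLM : XStar →L[ℝ] XStar) := by
  rw [injective_iff_map_eq_zero]
  intro f hf
  have hT : evenOpCLM f = f := (sub_eq_zero.1 (show f - evenOpCLM f = 0 from hf)).symm
  have hit : ∀ n : ℕ, (f : ℝ →ₘ[volume] ℝ) =ᵐ[volume] evenOp^[n] (XStar.rep f) := by
    intro n
    induction n with
    | zero => exact (XStar.rep_ae_eq f).symm
    | succ n ih =>
      rw [Function.iterate_succ_apply']
      have h := coe_evenOpCLM_ae_eq f ih.symm
      rwa [hT] at h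
  have hn : ∀ n : ℕ, ‖f‖ ≤ 2 * ((3 / 4) ^ n * (‖f‖ + 1000 * ‖f‖)) := by
    intro n
    obtain ⟨r, A, h, hle⟩ := (XStar.oscControl_rep f).iterate_evenOp n
    have h2 : ‖f‖ = xStarNorm (evenOp^[n] (XStar.rep f)) := xStarNorm_congr (hit n)
    linarith [h.xStarNorm_le]
  have hlim : Filter.Tendsto (fun n : ℕ => 2 * ((3 / 4 : ℝ) ^ n * (‖f‖ + 1000 * ‖f‖)))
      Filter.atTop (nhds (2 * (0 * (‖f‖ + 1000 * ‖f‖)))) :=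
    ((tendsto_pow_atTop_nhds_zero_of_lt_one (by norm_num) (by norm_num)).mul_const _).const_mul _
  have h0 := ge_of_tendsto' hlim hn
  rw [zero_mul, mul_zero] at h0
  exact norm_le_zero_iff.1 h0

/-- The inverse has an explicit bound, so completeness of the space is not needed. -/
theorem isUnit_one_sub_evenOpCLM : IsUnit (1 - evenOpCLM) := by
  have hsurj : Function.Surjective ⇑(1 - evenOpCLM : XStar →L[ℝ] XStar) := fun g =>
    (exists_one_sub_evenOpCLM_eq g).imp fun _ h => h.1
  let e : XStar ≃ₗ[ℝ] XStar := LinearEquiv.ofBijective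
    (1 - evenOpCLM : XStar →L[ℝ] XStar).toLinearMap
    ⟨injective_one_sub_evenOpCLM, hsurj⟩
  let E := e.toContinuousLinearEquivOfBounds ‖1 - evenOpCLM‖ 8008
    (fun f => (1 - evenOpCLM).le_opNorm f) fun g => by
      obtain ⟨f, hf, hle⟩ := exists_one_sub_evenOpCLM_eq g
      have : e.symm g = f := e.symm_apply_eq.2 hf.symm
      rwa [this]
  have hE : ((ContinuousLinearEquiv.toUnit E : (XStar →L[ℝ] XStar)ˣ) : XStar →L[ℝ] XStar) =
      1 - evenOpCLM := by
    ext f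
    rfl
  exact ⟨_, hE⟩

/-! ### Remainders of irrational numbers -/

theorem absFrac_eq (α x : ℝ) : absFrac α x = |x - ⌊x - α + 1⌋| := by
  unfold absFrac
  congr 1
  rw [Int.fract]
  ring

theorem irrational_absFrac (α : ℝ) {x : ℝ} (hx : Irrational x) : Irrational (absFrac α x) := by
  rw [absFrac_eq]
  rcases abs_choice (x - ⌊x - α + 1⌋) with h | h <;> rw [h]
  · exact hx.sub_intCast _
  · exact (hx.sub_intCast _).neg

theorem absFrac_pos (α : ℝ) {x : ℝ} (hx : Irrational x) : 0 < absFrac α x :=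
  (abs_nonneg _).lt_of_ne (irrational_absFrac α hx).ne_zero.symm

theorem absFrac_le {α : ℝ} (hα : 1 / 2 ≤ α) (x : ℝ) : absFrac α x ≤ α := by
  have h0 := Int.fract_nonneg (x - α + 1)
  have h1 := Int.fract_lt_one (x - α + 1)
  unfold absFrac
  exact abs_le.2 ⟨by linarith, by linarith⟩

theorem absFrac_add_one (α x : ℝ) : absFrac α (x + 1) = absFrac α x := by
  unfold absFrac
  rw [show x + 1 - α + 1 = x - α + 1 + 1 by ring, Int.fract_add_one]

theorem absFrac_of_fract_lt {α x : ℝ} (hα : α ≤ 1) (h : Int.fract x < α) :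
    absFrac α x = Int.fract x := by
  have h0 := Int.fract_nonneg x
  have hf : ⌊x - α + 1⌋ = ⌊x⌋ := by
    rw [Int.floor_eq_iff]
    have := Int.self_sub_floor x
    constructor <;> linarith
  rw [absFrac_eq, hf, Int.self_sub_floor, abs_of_nonneg h0]

theorem absFrac_of_le_fract {α x : ℝ} (hα : 0 < α) (h : α ≤ Int.fract x) :
    absFrac α x = 1 - Int.fract x := by
  have h1 := Int.fract_lt_one x
  have hf : ⌊x - α + 1⌋ = ⌊x⌋ + 1 := by
    rw [Int.floor_eq_iff]
    have := Int.self_sub_floor x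
    push_cast
    constructor <;> linarith
  rw [absFrac_eq, hf]
  push_cast
  rw [← sub_sub, Int.self_sub_floor, abs_of_nonpos (by linarith)]
  ring

theorem cfMap_of_ne_zero (α : ℝ) {x : ℝ} (hx : x ≠ 0) : cfMap α x = absFrac α x⁻¹ := by
  unfold cfMap
  rw [if_neg hx]

theorem cfRem_inv {α x : ℝ} (hx : absFrac α x ≠ 0) (n : ℕ) :
    cfRem α (absFrac α x)⁻¹ n = cfRem α x (n + 1) := by
  induction n with
  | zero => exact (cfMap_of_ne_zero α hx).symm
  | succ n ih =>
    change cfMap α (cfRem α (absFrac α x)⁻¹ n) = cfMap α (cfRem α x (n + 1))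
    rw [ih]

theorem irrational_cfRem (α : ℝ) {x : ℝ} (hx : Irrational x) (n : ℕ) :
    Irrational (cfRem α x n) := by
  induction n with
  | zero => exact irrational_absFrac α hx
  | succ n ih =>
    change Irrational (cfMap α (cfRem α x n))
    rw [cfMap_of_ne_zero α ih.ne_zero]
    exact irrational_absFrac α ih.inv

theorem cfRem_nonneg (α x : ℝ) (n : ℕ) : 0 ≤ cfRem α x n := by
  cases n with
  | zero => exact abs_nonneg _
  | succ n =>
    change 0 ≤ cfMap α (cfRem α x n)
    unfold cfMap
    split_ifs
    · exact le_rfl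
    · exact abs_nonneg _

theorem cfRem_le {α : ℝ} (hα : 1 / 2 ≤ α) (x : ℝ) (n : ℕ) : cfRem α x n ≤ α := by
  cases n with
  | zero => exact absFrac_le hα x
  | succ n =>
    change cfMap α (cfRem α x n) ≤ α
    unfold cfMap
    split_ifs
    · linarith
    · exact absFrac_le hα _

theorem negLog_of_pos {t : ℝ} (ht : 0 < t) : negLog t = ENNReal.ofReal (-Real.log t) :=
  if_neg ht.not_ge

theorem cfRem_add_one (α x : ℝ) (n : ℕ) : cfRem α (x + 1) n = cfRem α x n := by
  induction n with
  | zero => exact absFrac_add_one α x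
  | succ n ih =>
    change cfMap α (cfRem α (x + 1) n) = cfMap α (cfRem α x n)
    rw [ih]

theorem measurable_cfRem (α : ℝ) (n : ℕ) : Measurable fun x => cfRem α x n := by
  induction n with
  | zero => exact measurable_absFrac α
  | succ n ih =>
    have h : Measurable (cfMap α) :=
      Measurable.ite (measurableSet_singleton 0) measurable_const
        ((measurable_absFrac α).comp measurable_inv)
    exact h.comp ih

theorem measurable_negLog : Measurable negLog :=
  Measurable.ite measurableSet_Iic measurable_const Real.measurable_log.neg.ennreal_ofReal

theorem measurable_brjunoFun (α : ℝ) : Measurable (brjunoFun α) := by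
  unfold brjunoFun
  exact Measurable.tsum fun n =>
    (Finset.measurable_fun_prod _ fun k _ => measurable_cfRem α k).ennreal_ofReal.mul
      (measurable_negLog.comp (measurable_cfRem α n))

/-! ### Comparison of the Brjuno functions -/

/-- The sum of the first `N` terms of the Brjuno series. -/
def brjunoPartial (α : ℝ) (N : ℕ) (x : ℝ) : ℝ≥0∞ :=
  ∑ n ∈ Finset.range N, ENNReal.ofReal (∏ k ∈ Finset.range n, cfRem α x k) * negLog (cfRem α x n)

theorem brjunoPartial_le_succ (α : ℝ) (N : ℕ) (x : ℝ) :
    brjunoPartial α N x ≤ brjunoPartial α (N + 1) x := by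
  unfold brjunoPartial
  rw [Finset.sum_range_succ]
  exact le_self_add

theorem brjunoFun_le {α x : ℝ} {C : ℝ≥0∞} (h : ∀ N, brjunoPartial α N x ≤ C) :
    brjunoFun α x ≤ C := ENNReal.tsum_le_of_sum_range_le h

theorem brjuno_term_succ {α x : ℝ} (hx : Irrational x) (n : ℕ) :
    ENNReal.ofReal (∏ k ∈ Finset.range (n + 1), cfRem α x k) * negLog (cfRem α x (n + 1)) =
      ENNReal.ofReal (absFrac α x) *
        (ENNReal.ofReal (∏ k ∈ Finset.range n, cfRem α (absFrac α x)⁻¹ k) *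
          negLog (cfRem α (absFrac α x)⁻¹ n)) := by
  have h0 := (irrational_absFrac α hx).ne_zero
  simp only [cfRem_inv h0]
  rw [Finset.prod_range_succ', mul_comm (∏ k ∈ _, _),
    ENNReal.ofReal_mul (cfRem_nonneg α x 0), mul_assoc]
  rfl

theorem brjunoPartial_succ {α x : ℝ} (hx : Irrational x) (N : ℕ) :
    brjunoPartial α (N + 1) x = negLog (absFrac α x) +
      ENNReal.ofReal (absFrac α x) * brjunoPartial α N (absFrac α x)⁻¹ := by
  unfold brjunoPartial
  rw [Finset.sum_range_succ', Finset.mul_sum, add_comm]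
  simp only [brjuno_term_succ hx]
  simp [cfRem]

theorem brjunoFun_eq {α x : ℝ} (hx : Irrational x) :
    brjunoFun α x = negLog (absFrac α x) +
      ENNReal.ofReal (absFrac α x) * brjunoFun α (absFrac α x)⁻¹ := by
  unfold brjunoFun
  rw [tsum_eq_zero_add' ENNReal.summable, ← ENNReal.tsum_mul_left]
  simp only [brjuno_term_succ hx]
  simp [cfRem]

theorem brjunoFun_add_one (α x : ℝ) : brjunoFun α (x + 1) = brjunoFun α x := by
  unfold brjunoFun
  simp only [cfRem_add_one]

theorem brjunoPartial_add_one (α : ℝ) (N : ℕ) (x : ℝ) :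
    brjunoPartial α N (x + 1) = brjunoPartial α N x := by
  unfold brjunoPartial
  simp only [cfRem_add_one]

/-- The sum of two steps of the Gauss map, when the first digit is one. -/
theorem gauss_two_steps {x : ℝ} (h2 : 1 / 2 < Int.fract x) :
    absFrac 1 (absFrac 1 x)⁻¹ = (1 - Int.fract x) / Int.fract x ∧
    ∀ b : ℝ≥0∞, negLog (absFrac 1 x) + ENNReal.ofReal (absFrac 1 x) *
      (negLog (absFrac 1 (absFrac 1 x)⁻¹) + ENNReal.ofReal (absFrac 1 (absFrac 1 x)⁻¹) * b) =
      ENNReal.ofReal (-((1 - Int.fract x) * Real.log (Int.fract x)) -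
        Int.fract x * Real.log (1 - Int.fract x)) + ENNReal.ofReal (1 - Int.fract x) * b := by
  have h1 := Int.fract_lt_one x
  rw [absFrac_of_fract_lt le_rfl h1]
  set t := Int.fract x
  have ht0 : 0 < t := by linarith
  have hs : absFrac 1 t⁻¹ = (1 - t) / t := by
    have hfl : ⌊t⁻¹⌋ = 1 := by
      rw [Int.floor_eq_iff]
      push_cast
      constructor
      · exact (one_le_inv₀ ht0).2 h1.le
      · rw [inv_lt_iff_one_lt_mul₀ ht0]
        linarith
    rw [absFrac_of_fract_lt le_rfl (Int.fract_lt_one _), Int.fract, hfl]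
    push_cast
    field_simp
  refine ⟨hs, fun b => ?_⟩
  have hs0 : 0 < (1 - t) / t := div_pos (by linarith) ht0
  have hs1 : (1 - t) / t ≤ 1 := by
    rw [div_le_one ht0]
    linarith
  have hlt : Real.log t ≤ 0 := Real.log_nonpos ht0.le h1.le
  have hls : Real.log ((1 - t) / t) ≤ 0 := Real.log_nonpos hs0.le hs1
  rw [hs, negLog_of_pos ht0, negLog_of_pos hs0, mul_add, ← add_assoc, ← mul_assoc,
    ← ENNReal.ofReal_mul ht0.le, ← ENNReal.ofReal_mul ht0.le, ← ENNReal.ofReal_add (by linarith)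
      (mul_nonneg ht0.le (by linarith))]
  congr 2
  · rw [Real.log_div (by linarith) ht0.ne']
    ring_nf
  · congr 1
    field_simp

/-- After two Gauss steps the orbit continues from 1/x₁, which differs by 1 from 1/(1-t), the point
reached by one folded step. By periodicity the tails agree. -/
theorem inv_gauss_two_steps {t : ℝ} (h1 : t < 1) : ((1 - t) / t)⁻¹ + 1 = (1 - t)⁻¹ := by
  have : 1 - t ≠ 0 := by linarith
  field_simp
  ring

theorem brjunoFun_one_of_half_lt {x : ℝ} (hx : Irrational x) (h2 : 1 / 2 < Int.fract x) :
    brjunoFun 1 x = ENNReal.ofReal (-((1 - Int.fract x) * Real.log (Int.fract x)) -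
        Int.fract x * Real.log (1 - Int.fract x)) +
      ENNReal.ofReal (1 - Int.fract x) * brjunoFun 1 (1 - Int.fract x)⁻¹ := by
  obtain ⟨hs, h⟩ := gauss_two_steps h2
  rw [brjunoFun_eq hx, brjunoFun_eq (irrational_absFrac 1 hx).inv, h, hs,
    ← brjunoFun_add_one, inv_gauss_two_steps (Int.fract_lt_one x)]

theorem brjunoPartial_one_of_half_lt {x : ℝ} (hx : Irrational x) (h2 : 1 / 2 < Int.fract x)
    (N : ℕ) :
    brjunoPartial 1 (N + 2) x = ENNReal.ofReal (-((1 - Int.fract x) * Real.log (Int.fract x)) -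
        Int.fract x * Real.log (1 - Int.fract x)) +
      ENNReal.ofReal (1 - Int.fract x) * brjunoPartial 1 N (1 - Int.fract x)⁻¹ := by
  obtain ⟨hs, h⟩ := gauss_two_steps h2
  rw [brjunoPartial_succ hx, brjunoPartial_succ (irrational_absFrac 1 hx).inv, h, hs,
    ← brjunoPartial_add_one, inv_gauss_two_steps (Int.fract_lt_one x)]

/-- Irrationality excludes the value 1/2, which could occur only for α = 1/2. -/
theorem half_lt_fract {α x : ℝ} (hx : Irrational x) (hα : 1 / 2 ≤ α) (h : α ≤ Int.fract x) :
    1 / 2 < Int.fract x := by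
  refine (hα.trans h).lt_of_ne fun e => (hx.sub_intCast ⌊x⌋) ⟨1 / 2, ?_⟩
  rw [Int.self_sub_floor, ← e]
  push_cast
  rfl

/-- Partial sums allow an induction along the functional equation even where the series diverges. -/
theorem brjunoPartial_one_le_brjunoFun {α : ℝ} (hα : α ∈ Icc (1 / 2 : ℝ) 1) (N : ℕ) :
    ∀ x : ℝ, Irrational x → brjunoPartial 1 N x ≤ brjunoFun α x := by
  induction N with
  | zero => intro x _; simp [brjunoPartial]
  | succ N ih =>
    intro x hx
    have hx' := (irrational_absFrac α hx).inv
    rw [brjunoFun_eq (α := α) hx]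
    rcases lt_or_ge (Int.fract x) α with h | h
    · rw [brjunoPartial_succ hx]
      rw [absFrac_of_fract_lt hα.2 h] at hx' ⊢
      rw [absFrac_of_fract_lt le_rfl (Int.fract_lt_one x)]
      gcongr
      exact ih _ hx'
    -- An extra Gauss term is granted, so that two Gauss steps match one α-step.
    · refine (brjunoPartial_le_succ 1 (N + 1) x).trans ?_
      have h2 := half_lt_fract hx hα.1 h
      have h1 := Int.fract_lt_one x
      rw [brjunoPartial_one_of_half_lt hx h2]
      rw [absFrac_of_le_fract (by linarith [hα.1]) h] at hx' ⊢
      rw [negLog_of_pos (by linarith)]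
      gcongr
      · have : (1 - Int.fract x) * Real.log (1 - Int.fract x) ≤
            (1 - Int.fract x) * Real.log (Int.fract x) :=
          mul_le_mul_of_nonneg_left (Real.log_le_log (by linarith) (by linarith)) (by linarith)
        linarith
      · exact ih _ hx'

/-- One step costs at most 1 and the error inherited from the tail is multiplied by at most α; C =
1/(1 - α) solves 1 + αC = C. -/
theorem brjunoPartial_le_brjunoFun_one {α : ℝ} (hα : 1 / 2 ≤ α) (hα1 : α < 1) (N : ℕ) :
    ∀ x : ℝ, Irrational x →
      brjunoPartial α N x ≤ brjunoFun 1 x + ENNReal.ofReal (1 / (1 - α)) := by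
  have hC : 0 < 1 / (1 - α) := one_div_pos.2 (by linarith)
  induction N with
  | zero => intro x _; simp [brjunoPartial]
  | succ N ih =>
    intro x hx
    have hx' := (irrational_absFrac α hx).inv
    have key : negLog (absFrac α x) + ENNReal.ofReal (absFrac α x) * brjunoFun 1 (absFrac α x)⁻¹ ≤
        brjunoFun 1 x + ENNReal.ofReal 1 := by
      rcases lt_or_ge (Int.fract x) α with h | h
      · rw [brjunoFun_eq (α := 1) hx, absFrac_of_fract_lt hα1.le h,
          absFrac_of_fract_lt le_rfl (Int.fract_lt_one x)]
        exact le_self_add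
      · have h2 := half_lt_fract hx hα h
        have h1 := Int.fract_lt_one x
        rw [brjunoFun_one_of_half_lt hx h2, absFrac_of_le_fract (by linarith) h,
          negLog_of_pos (by linarith), add_right_comm]
        gcongr
        have hpos : 0 ≤ -((1 - Int.fract x) * Real.log (Int.fract x)) -
            Int.fract x * Real.log (1 - Int.fract x) := by
          have l1 : Real.log (Int.fract x) ≤ 0 := Real.log_nonpos (by linarith) h1.le
          have l2 : Real.log (1 - Int.fract x) ≤ 0 := Real.log_nonpos (by linarith) (by linarith)
          nlinarith
        rw [← ENNReal.ofReal_add hpos zero_le_one]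
        refine ENNReal.ofReal_le_ofReal ?_
        -- The excess (1-t)(log t - log(1-t)) is at most 2t - 1 ≤ 1.
        have := mul_log_sub_log_le (u := 1 - Int.fract x) (M := Int.fract x) (by linarith)
          (by linarith)
        linarith
    calc brjunoPartial α (N + 1) x = negLog (absFrac α x) +
          ENNReal.ofReal (absFrac α x) * brjunoPartial α N (absFrac α x)⁻¹ :=
          brjunoPartial_succ hx N
      _ ≤ negLog (absFrac α x) + ENNReal.ofReal (absFrac α x) *
          (brjunoFun 1 (absFrac α x)⁻¹ + ENNReal.ofReal (1 / (1 - α))) := by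
          gcongr
          exact ih _ hx'
      _ = negLog (absFrac α x) + ENNReal.ofReal (absFrac α x) * brjunoFun 1 (absFrac α x)⁻¹ +
          ENNReal.ofReal (absFrac α x) * ENNReal.ofReal (1 / (1 - α)) := by
          rw [mul_add, add_assoc]
      _ ≤ brjunoFun 1 x + ENNReal.ofReal 1 + ENNReal.ofReal (α * (1 / (1 - α))) := by
          rw [← ENNReal.ofReal_mul (absFrac_pos α hx).le]
          refine add_le_add key (ENNReal.ofReal_le_ofReal ?_)
          gcongr
          exact absFrac_le hα x
      _ = brjunoFun 1 x + ENNReal.ofReal (1 / (1 - α)) := by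
          rw [add_assoc, ← ENNReal.ofReal_add zero_le_one (by positivity)]
          congr 2
          have : 1 - α ≠ 0 := by linarith
          field_simp
          ring

theorem exists_brjunoFun_le {α : ℝ} (hα : α ∈ Icc (1 / 2 : ℝ) 1) :
    ∃ C : ℝ≥0, ∀ x : ℝ, Irrational x → brjunoFun α x ≤ brjunoFun 1 x + C := by
  rcases hα.2.eq_or_lt with h | h
  · exact ⟨0, fun x _ => by rw [h]; exact le_self_add⟩
  · exact ⟨(1 / (1 - α)).toNNReal, fun x hx =>
      brjunoFun_le fun N => brjunoPartial_le_brjunoFun_one hα.1 h N x hx⟩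

/-- The Gauss case is the smallest and serves as the link between α and 1/2. -/
theorem exists_brjunoFun_sub_le {α : ℝ} (hα : α ∈ Icc (1 / 2 : ℝ) 1) :
    ∃ C : ℝ≥0, ∀ x : ℝ, Irrational x →
      brjunoFun α x ≤ brjunoFun (1 / 2) x + C ∧ brjunoFun (1 / 2) x ≤ brjunoFun α x + C := by
  have hh : (1 / 2 : ℝ) ∈ Icc (1 / 2 : ℝ) 1 := ⟨le_rfl, by norm_num⟩
  have hlow : ∀ {β : ℝ}, β ∈ Icc (1 / 2 : ℝ) 1 → ∀ x, Irrational x →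
      brjunoFun 1 x ≤ brjunoFun β x := fun hβ x hx =>
    brjunoFun_le fun N => brjunoPartial_one_le_brjunoFun hβ N x hx
  obtain ⟨C, hC⟩ := exists_brjunoFun_le hα
  obtain ⟨D, hD⟩ := exists_brjunoFun_le hh
  refine ⟨max C D, fun x hx => ⟨(hC x hx).trans ?_, (hD x hx).trans ?_⟩⟩
  · exact add_le_add (hlow hh x hx) (by exact_mod_cast le_max_left C D)
  · exact add_le_add (hlow hα x hx) (by exact_mod_cast le_max_right C D)

/-! ### The even Brjuno function and its perturbations -/

theorem iterate_evenOp_evenNegLog {x : ℝ} (n : ℕ) (hx : Irrational x) :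
    evenOp^[n] evenNegLog x =
      (∏ k ∈ Finset.range n, cfRem (1 / 2) x k) * -Real.log (cfRem (1 / 2) x n) := by
  induction n generalizing x with
  | zero => simp [evenNegLog, cfRem]
  | succ n ih =>
    have h0 := irrational_absFrac (1 / 2) hx
    rw [Function.iterate_succ_apply', evenOp, ih h0.inv]
    simp only [cfRem_inv h0.ne_zero]
    rw [Finset.prod_range_succ', mul_right_comm, mul_comm]
    rfl

theorem brjunoFun_half_eq {x : ℝ} (hx : Irrational x) :
    brjunoFun (1 / 2) x = ∑' n : ℕ, ENNReal.ofReal (evenOp^[n] evenNegLog x) := by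
  unfold brjunoFun
  refine tsum_congr fun n => ?_
  have hpos : 0 < cfRem (1 / 2) x n :=
    (cfRem_nonneg _ x n).lt_of_ne (irrational_cfRem _ hx n).ne_zero.symm
  rw [iterate_evenOp_evenNegLog n hx, negLog_of_pos hpos,
    ENNReal.ofReal_mul (Finset.prod_nonneg fun k _ => cfRem_nonneg _ x k)]

theorem iterate_evenOp_evenNegLog_nonneg {x : ℝ} (n : ℕ) (hx : Irrational x) :
    0 ≤ evenOp^[n] evenNegLog x := by
  rw [iterate_evenOp_evenNegLog n hx]
  exact mul_nonneg (Finset.prod_nonneg fun k _ => cfRem_nonneg _ x k)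
    (neg_nonneg.2 (Real.log_nonpos (cfRem_nonneg _ x n)
      ((cfRem_le le_rfl x n).trans (by norm_num))))

/-- This holds also where the series diverges, both sides being 0 by convention. -/
theorem toReal_brjunoFun_half {x : ℝ} (hx : Irrational x) :
    (brjunoFun (1 / 2) x).toReal = neumann evenNegLog x := by
  rw [brjunoFun_half_eq hx, ENNReal.tsum_toReal_eq fun n => ENNReal.ofReal_ne_top]
  exact tsum_congr fun n => ENNReal.toReal_ofReal (iterate_evenOp_evenNegLog_nonneg n hx)

theorem ae_irrational : ∀ᵐ x ∂(volume : Measure ℝ), Irrational x :=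
  (countable_range ((↑) : ℚ → ℝ)).ae_notMem volume

theorem toReal_brjunoFun_half_ae_eq :
    (fun x => (brjunoFun (1 / 2) x).toReal) =ᵐ[volume] neumann evenNegLog :=
  ae_irrational.mono fun _ hx => toReal_brjunoFun_half hx

theorem isBMO_of_ae_abs_le {f : ℝ → ℝ} {C : ℝ} (hf : AEStronglyMeasurable f volume)
    (h : ∀ᵐ x ∂volume, |f x| ≤ C) : IsBMO f := by
  obtain ⟨x0, hx0⟩ := h.exists
  have hC : 0 ≤ C := (abs_nonneg _).trans hx0
  have hloc : LocallyIntegrable f volume :=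
    (locallyIntegrable_const C).mono hf (h.mono fun x hx => by
      rw [Real.norm_eq_abs, Real.norm_of_nonneg hC]
      exact hx)
  refine ⟨hloc, 2 * C, ?_⟩
  rintro _ ⟨a, b, hab, -, rfl⟩
  have hba : 0 < b - a := sub_pos.2 hab
  have hc : ∫⁻ x in Ioo a b, ‖f x - 0‖ₑ ≤ ENNReal.ofReal (C * (b - a)) := by
    rw [← abs_of_nonneg hC, ← setLIntegral_Ioo_const]
    refine lintegral_mono_ae (ae_restrict_of_ae (h.mono fun x hx => ?_))
    rw [sub_zero, Real.enorm_eq_ofReal_abs, Real.enorm_of_nonneg hC]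
    exact ENNReal.ofReal_le_ofReal hx
  refine (meanOsc_le_of_setLIntegral_le hloc hab (by positivity) hc).trans (le_of_eq ?_)
  field_simp

/-- The two values are infinite together, and then both real values are 0. -/
theorem abs_toReal_sub_le {u v : ℝ≥0∞} {C : ℝ≥0} (h1 : u ≤ v + C) (h2 : v ≤ u + C) :
    |u.toReal - v.toReal| ≤ C := by
  by_cases hu : u = ∞
  · have hv : v = ∞ := by
      by_contra hv
      exact (ENNReal.add_ne_top.2 ⟨hv, ENNReal.coe_ne_top⟩) (top_le_iff.1 (hu ▸ h1))
    simp [hu, hv]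
  have hv : v ≠ ∞ := ne_top_of_le_ne_top (ENNReal.add_ne_top.2 ⟨hu, ENNReal.coe_ne_top⟩) h2
  lift u to ℝ≥0 using hu
  lift v to ℝ≥0 using hv
  norm_cast at h1 h2
  rw [ENNReal.coe_toReal, ENNReal.coe_toReal, abs_le]
  have h1' : (u : ℝ) ≤ v + C := by exact_mod_cast h1
  have h2' : (v : ℝ) ≤ u + C := by exact_mod_cast h2
  exact ⟨by linarith, by linarith⟩

theorem memXStar_evenNegLog : MemXStar evenNegLog :=
  exists_oscControl_evenNegLog.choose_spec.memXStar

theorem memXStar_brjunoFun_half : MemXStar fun x => (brjunoFun (1 / 2) x).toReal := by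
  obtain ⟨A, hA⟩ := exists_oscControl_evenNegLog
  obtain ⟨-, ⟨r', A', h, -⟩, -⟩ := hA.neumann
  exact memXStar_congr toReal_brjunoFun_half_ae_eq.symm h.memXStar

theorem one_sub_evenOpCLM_brjunoFun :
    (1 - evenOpCLM) (XStar.ofFun _ memXStar_brjunoFun_half) =
      XStar.ofFun _ memXStar_evenNegLog := by
  obtain ⟨A, hA⟩ := exists_oscControl_evenNegLog
  exact one_sub_evenOpCLM_eq
    ((XStar.coe_ofFun_ae_eq memXStar_brjunoFun_half).trans toReal_brjunoFun_half_ae_eq)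
    (XStar.coe_ofFun_ae_eq memXStar_evenNegLog) hA.neumann.2.2

/-- Almost everywhere finiteness of the even Brjuno function. -/
theorem ae_brjunoFun_half_ne_top : ∀ᵐ x ∂volume, brjunoFun (1 / 2) x ≠ ∞ := by
  obtain ⟨A, hA⟩ := exists_oscControl_evenNegLog
  filter_upwards [hA.neumann.1, ae_irrational] with x hs hx
  rw [brjunoFun_half_eq hx]
  exact hs.tsum_ofReal_ne_top

theorem ae_brjunoFun_ne_top {α : ℝ} (hα : α ∈ Icc (1 / 2 : ℝ) 1) :
    ∀ᵐ x ∂volume, brjunoFun α x ≠ ∞ := by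
  obtain ⟨C, hC⟩ := exists_brjunoFun_sub_le hα
  filter_upwards [ae_brjunoFun_half_ne_top, ae_irrational] with x h hx
  exact ne_top_of_le_ne_top (ENNReal.add_ne_top.2 ⟨h, ENNReal.coe_ne_top⟩) (hC x hx).1

theorem isBMO_brjunoFun {α : ℝ} (hα : α ∈ Icc (1 / 2 : ℝ) 1) :
    IsBMO fun x => (brjunoFun α x).toReal := by
  obtain ⟨C, hC⟩ := exists_brjunoFun_sub_le hα
  have hm : ∀ β : ℝ, Measurable fun x => (brjunoFun β x).toReal :=
    fun β => (measurable_brjunoFun β).ennreal_toReal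
  have hd : IsBMO fun x => (brjunoFun α x).toReal - (brjunoFun (1 / 2) x).toReal :=
    isBMO_of_ae_abs_le (C := C) ((hm α).sub (hm _)).aestronglyMeasurable
      (ae_irrational.mono fun x hx => abs_toReal_sub_le (hC x hx).1 (hC x hx).2)
  have h := isBMO_add memXStar_brjunoFun_half.1 hd
  have e : (fun x => (brjunoFun (1 / 2) x).toReal) +
      (fun x => (brjunoFun α x).toReal - (brjunoFun (1 / 2) x).toReal) =
      fun x => (brjunoFun α x).toReal := by
    ext x
    simp only [Pi.add_apply, add_sub_cancel]
  rwa [e] at h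

end Brjuno

end

theorem mainTheorem6 :
    (∃ T : Brjuno.XStar →L[ℝ] Brjuno.XStar,
      (∀ (f : Brjuno.XStar) (g : ℝ → ℝ), g =ᵐ[volume] (f : ℝ →ₘ[volume] ℝ) →
        (T f : ℝ →ₘ[volume] ℝ) =ᵐ[volume] Brjuno.evenOp g) ∧
      IsUnit (1 - T) ∧
      ∃ (hL : Brjuno.MemXStar Brjuno.evenNegLog)
        (hB : Brjuno.MemXStar fun x => (Brjuno.brjunoFun (1 / 2) x).toReal),
        (1 - T) (Brjuno.XStar.ofFun _ hB) = Brjuno.XStar.ofFun _ hL) ∧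
    ∀ α ∈ Icc (1 / 2 : ℝ) 1,
      (∃ C : ℝ≥0, ∀ x : ℝ, Irrational x →
        Brjuno.brjunoFun α x ≤ Brjuno.brjunoFun (1 / 2) x + C ∧
        Brjuno.brjunoFun (1 / 2) x ≤ Brjuno.brjunoFun α x + C) ∧
      (∀ᵐ x ∂volume, Brjuno.brjunoFun α x ≠ ∞) ∧
      Brjuno.IsBMO fun x => (Brjuno.brjunoFun α x).toReal := by
  refine ⟨⟨Brjuno.evenOpCLM, fun f g hg => Brjuno.coe_evenOpCLM_ae_eq f hg,
    Brjuno.isUnit_one_sub_evenOpCLM, Brjuno.memXStar_evenNegLog, Brjuno.memXStar_brjunoFun_half,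
    Brjuno.one_sub_evenOpCLM_brjunoFun⟩, fun α hα => ⟨Brjuno.exists_brjunoFun_sub_le hα,
    Brjuno.ae_brjunoFun_ne_top hα, Brjuno.isBMO_brjunoFun hα⟩⟩
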